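/- Let $E$ be a complex elliptic curve, $n\ge 1$ and $p\ge 0$ integers, and let $M(A_{n-1})=\{P\in E^n : P_i\ne P_j \text{ for } i\neq j\}$ be the complement of the braid elliptic arrangement with divisors $D_{ij}=\{P_i=P_j\}$, on which $E$ acts by diagonal translation. Let $$E_2^{p,q}(M(A_{n-1})/E)=\bigoplus_{\operatorname{rk}W=q}H^p(W/E;\mathbb Q)\otimes H^q(M(\mathcal A_W);\mathbb Q)$$ be the second page of the Leray spectral sequence of the inclusion $M(A_{n-1})/E\hookrightarrow E^n/E$. Here $W$ runs over the layers of the arrangement (the subtori defined by the partitions of $\{1,\dots,n\}$), $\operatorname{rk}W$ is the codimension of $W$, and $M(\mathcal A_W)$ is the complement of the local hyperplane arrangement $\mathcal A_W$ at $W$, whose cohomology is its Orlik–Solomon algebra. The differential $d:E_2^{p,q}\to E_2^{p+2,q-1}$ is $$d(x\otimes\omega)=\sum_{L\supset W,\ \operatorname{rk}L=\operatorname{rk}W-1}G_L(x)\otimes\sigma_L(\omega),$$ where $G_L$ is the Gysin map of $W/E\subset L/E$ and $\sigma_L$ is the $L$-component of the Orlik–Solomon derivation $\partial$ (with $\partial\omega_{ij}=1$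 on the generators). Let $E_3^{p,q}(M(A_{n-1})/E)$ be the cohomology of $(E_2,d)$. The group $S_n$ acts by permuting the coordinates, and $SL_2(\mathbb Q)$ acts through its standard action on $H^1(E;\mathbb Q)=\mathbb Qx\oplus\mathbb Qy$, where $x,y$ is a $\mathbb Z$-basis of $H^1(E;\mathbb Z)$. Let $V(1)$ be the standard representation of $S_n$, of dimension $n-1$, and let $\mathbb V_p=\operatorname{Sym}^p(\mathbb Q^2)$ be the irreducible representation of $SL_2(\mathbb Q)$ of dimension $p+1$. For $p\le n-1$ let $V(1,\dots,1)$, with $p$ ones, be the irreducible representation (Specht module) of $S_n$ attached to the partition $(n-p,1^p)$. Then there is an isomorphism of $S_n\times SL_2(\mathbb Q)$-representations $$E_3^{p,0}(M(A_{n-1})/E)\;\cong\;\textstyle\bigwedge^pV(1)\boxtimes\mathbb V_p ,$$ and for $p\le n-1$ also $$E_3^{p,0}(M(A_{n-1})/E)\;\cong\;V(\underbrace{1,\dots,1}_{p})\boxtimes\mathbb V_p .$$ Moreover $E_3^{p,0}(M(A_{n-1})/E)$ has dimension $\binom{n-1}{p}(p+1)$. -/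

import Mathlib

open scoped TensorProduct

namespace EllipticBraid

noncomputable section

/-! ### The first cohomology of the elliptic curve -/

/-- `H¹(E; ℚ) = Hom(H₁(E; ℤ), ℚ)` for the elliptic curve `E = ℂ/L`, where `L = H₁(E; ℤ)` is the
period lattice. -/
def H1E (Λ : PeriodPair) : Type := Λ.lattice →ₗ[ℤ] ℚ

instance (Λ : PeriodPair) : AddCommGroup (H1E Λ) :=
  inferInstanceAs (AddCommGroup (Λ.lattice →ₗ[ℤ] ℚ))

instance (Λ : PeriodPair) : Module ℚ (H1E Λ) :=
  inferInstanceAs (Module ℚ (Λ.lattice →ₗ[ℤ] ℚ))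

/-- The basis `x, y` of `H¹(E; ℚ)` dual to the chosen `ℤ`-basis of periods; it is a `ℤ`-basis of
`H¹(E; ℤ)`, so `x y` generates `H²(E; ℤ)`. -/
def xyBasis (Λ : PeriodPair) : Module.Basis (Fin 2) ℚ (H1E Λ) :=
  Module.Basis.ofEquivFun (Λ.latticeBasis.constr ℚ).symm

/-- The group `SL₂(ℚ)`. -/
abbrev SL2 : Type := Matrix.SpecialLinearGroup (Fin 2) ℚ

/-- The standard action of `SL₂(ℚ)` on `H¹(E; ℚ)` in the basis `x, y`. -/
def slRep (Λ : PeriodPair) : Representation ℚ SL2 (H1E Λ) where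
  toFun A := Matrix.toLin (xyBasis Λ) (xyBasis Λ) A.1
  map_one' := by simp [Module.End.one_eq_id]
  map_mul' A B := by
    rw [Matrix.SpecialLinearGroup.coe_mul,
      Matrix.toLin_mul (xyBasis Λ) (xyBasis Λ) (xyBasis Λ)]; rfl

/-! ### The first cohomology of the layers modulo translation -/

/-- For a finite set `X`, pullback along a translation orbit `E → E^X`, from
`H¹(E^X) = ⨁_{b ∈ X} pr_b^* H¹(E)` to `H¹(E)`. -/
def orbitPullback (Λ : PeriodPair) (X : Type) : (X →₀ H1E Λ) →ₗ[ℚ] H1E Λ :=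
  Finsupp.lsum ℚ fun _ => LinearMap.id

/-- `H¹(E^X / E; ℚ)`, as the subspace of `H¹(E^X; ℚ)` of the classes that vanish on the orbits of
the diagonal translation action of `E`. -/
def H1 (Λ : PeriodPair) (X : Type) : Submodule ℚ (X →₀ H1E Λ) :=
  LinearMap.ker (orbitPullback Λ X)

variable {Λ : PeriodPair}

lemma orbitPullback_map {X Y : Type} (a : H1E Λ →ₗ[ℚ] H1E Λ) (φ : X → Y) (f : X →₀ H1E Λ) :
    orbitPullback Λ Y (Finsupp.lmapDomain (H1E Λ) ℚ φ (Finsupp.mapRange.linearMap a f)) =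
      a (orbitPullback Λ X f) := by
  induction f using Finsupp.induction_linear with
  | zero => simp
  | add f g hf hg => simp only [map_add, hf, hg]
  | single i h => simp [orbitPullback]

/-- The map `H¹(E^X / E) → H¹(E^Y / E)` that sends `pr_b^* h` to `pr_{φ b}^* (a h)`.
For `a = id` this is the pullback along `E^Y → E^X`, `P ↦ P ∘ φ`. -/
def H1map {X Y : Type} (a : H1E Λ →ₗ[ℚ] H1E Λ) (φ : X → Y) : H1 Λ X →ₗ[ℚ] H1 Λ Y :=
  (Finsupp.lmapDomain (H1E Λ) ℚ φ ∘ₗ Finsupp.mapRange.linearMap a).restrict fun f hf => by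
    have hf' : orbitPullback Λ X f = 0 := hf
    change orbitPullback Λ Y _ = 0
    rw [LinearMap.comp_apply, orbitPullback_map, hf', map_zero]

lemma H1map_coe {X Y : Type} (a : H1E Λ →ₗ[ℚ] H1E Λ) (φ : X → Y) (f : H1 Λ X) :
    (H1map a φ f : Y →₀ H1E Λ) =
      Finsupp.mapDomain φ (Finsupp.mapRange.linearMap a (f : X →₀ H1E Λ)) := rfl

lemma H1map_comp {X Y Z : Type} (a b : H1E Λ →ₗ[ℚ] H1E Λ) (φ : X → Y) (ψ : Y → Z) :
    H1map b ψ ∘ₗ H1map a φ = H1map (b ∘ₗ a) (ψ ∘ φ) := by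
  ext1 f
  apply Subtype.ext
  simp only [LinearMap.comp_apply, H1map_coe]
  generalize (f : X →₀ H1E Λ) = g
  induction g using Finsupp.induction_linear with
  | zero => simp
  | add f g hf hg => simp only [map_add, Finsupp.mapDomain_add, hf, hg]
  | single i h => simp

lemma H1map_id (X : Type) : H1map (Λ := Λ) LinearMap.id (id : X → X) = LinearMap.id := by
  ext1 f
  apply Subtype.ext
  simp [H1map_coe]

/-- `h ↦ (pr_b - pr_c)^* h = pr_b^* h - pr_c^* h`. -/
def delta {X : Type} (b c : X) : H1E Λ →ₗ[ℚ] H1 Λ X :=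
  LinearMap.codRestrict (H1 Λ X)
    (Finsupp.lsingle b - Finsupp.lsingle c : H1E Λ →ₗ[ℚ] (X →₀ H1E Λ)) fun h => by
    rw [H1, LinearMap.mem_ker, LinearMap.sub_apply, map_sub]
    simp [orbitPullback]

lemma delta_coe {X : Type} (b c : X) (h : H1E Λ) :
    (delta b c h : X →₀ H1E Λ) = Finsupp.single b h - Finsupp.single c h := rfl

lemma H1map_delta {X Y : Type} (a : H1E Λ →ₗ[ℚ] H1E Λ) (φ : X → Y) (b c : X) (h : H1E Λ) :
    H1map a φ (delta b c h) = delta (φ b) (φ c) (a h) := by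
  apply Subtype.ext
  rw [H1map_coe, delta_coe, delta_coe, map_sub, Finsupp.mapDomain_sub]
  simp

/-- The class `(pr_b - pr_c)^*(x y) = (x_b - x_c)(y_b - y_c)` in `H²(E^X / E)` of the divisor
`P_b = P_c`. -/
def divisorClass {X : Type} (b c : X) : ExteriorAlgebra ℚ (H1 Λ X) :=
  ExteriorAlgebra.ι ℚ (delta b c (xyBasis Λ 0)) * ExteriorAlgebra.ι ℚ (delta b c (xyBasis Λ 1))

lemma delta_swap {X : Type} (b c : X) (h : H1E Λ) : delta c b h = - delta b c h := by
  apply Subtype.ext; simp [delta_coe]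

lemma divisorClass_swap {X : Type} (b c : X) :
    divisorClass (Λ := Λ) c b = divisorClass b c := by
  simp [divisorClass, delta_swap b c]

lemma map_divisorClass {X Y : Type} (A : SL2) (φ : X → Y) (b c : X) :
    ExteriorAlgebra.map (H1map (slRep Λ A) φ) (divisorClass b c) = divisorClass (φ b) (φ c) := by
  have hdet : A.1 0 0 * A.1 1 1 - A.1 0 1 * A.1 1 0 = 1 := by
    rw [← Matrix.det_fin_two]; exact A.2
  have key : ∀ (j : Fin 2), ExteriorAlgebra.ι ℚ (delta (φ b) (φ c) (slRep Λ A (xyBasis Λ j))) =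
      A.1 0 j • ExteriorAlgebra.ι ℚ (delta (φ b) (φ c) (xyBasis Λ 0)) +
      A.1 1 j • ExteriorAlgebra.ι ℚ (delta (φ b) (φ c) (xyBasis Λ 1)) := by
    intro j
    have : slRep Λ A (xyBasis Λ j) = A.1 0 j • xyBasis Λ 0 + A.1 1 j • xyBasis Λ 1 := by
      change Matrix.toLin (xyBasis Λ) (xyBasis Λ) A.1 _ = _
      rw [Matrix.toLin_self, Fin.sum_univ_two]
    rw [this]
    rw [map_add, map_smul, map_smul, map_add, map_smul, map_smul]
  simp only [divisorClass, map_mul, ExteriorAlgebra.map_apply_ι, H1map_delta, key]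
  generalize delta (φ b) (φ c) (xyBasis Λ 0) = u
  generalize delta (φ b) (φ c) (xyBasis Λ 1) = v
  have hvu : ExteriorAlgebra.ι ℚ v * ExteriorAlgebra.ι ℚ u =
      - (ExteriorAlgebra.ι ℚ u * ExteriorAlgebra.ι ℚ v) :=
    eq_neg_of_add_eq_zero_left (ExteriorAlgebra.ι_add_mul_swap v u)
  simp only [mul_add, add_mul, smul_mul_assoc, mul_smul_comm, ExteriorAlgebra.ι_sq_zero, hvu,
    smul_zero, zero_add, add_zero, smul_neg, smul_smul]
  match_scalars
  linarith


/-! ### Layers of the braid arrangement -/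

/-- The rank (codimension in `E^n`) of the layer `{P | P_i = P_j whenever s i j}` attached to a
partition `s` of the set of coordinates. A partition `r` is finer than `s`, `r ≤ s`, iff the layer
of `r` contains the layer of `s`, so `≤` is the order of the poset of layers. The layer is
`E^X` with `X = Quotient s` the set of blocks. -/
def rk {n : ℕ} (s : Setoid (Fin n)) : ℕ := n - Nat.card (Quotient s)

/-- The permutation `π` of the coordinates carries the layer `s` to the layer `t`. -/
def Carries {n : ℕ} (π : Equiv.Perm (Fin n)) (s t : Setoid (Fin n)) : Prop :=
  ∀ i j, s i j ↔ t (π i) (π j)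

/-- The action of the symmetric group on the layers. -/
def act {n : ℕ} (π : Equiv.Perm (Fin n)) (s : Setoid (Fin n)) : Setoid (Fin n) :=
  s.comap π.symm

lemma carries_act {n : ℕ} (π : Equiv.Perm (Fin n)) (s : Setoid (Fin n)) :
    Carries π s (act π s) := fun i j => by
  change s i j ↔ s (π.symm (π i)) (π.symm (π j))
  rw [Equiv.symm_apply_apply, Equiv.symm_apply_apply]

lemma Carries.eq {n : ℕ} {π : Equiv.Perm (Fin n)} {s t : Setoid (Fin n)} (h : Carries π s t) :
    t = act π s := by
  ext i j
  have := h (π.symm i) (π.symm j)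
  simp only [Equiv.apply_symm_apply] at this
  exact this.symm

lemma Carries.symm {n : ℕ} {π : Equiv.Perm (Fin n)} {s t : Setoid (Fin n)} (h : Carries π s t) :
    Carries π.symm t s := fun i j => by
  rw [h]; simp

lemma Carries.trans {n : ℕ} {π ρ : Equiv.Perm (Fin n)} {s t u : Setoid (Fin n)}
    (h : Carries π s t) (h' : Carries ρ t u) : Carries (ρ * π) s u := fun i j => by
  rw [h, h']; rfl

/-- The map of blocks induced by a permutation. -/
def blockMap {n : ℕ} (π : Equiv.Perm (Fin n)) {s t : Setoid (Fin n)}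
    (h : ∀ i j, s i j → t (π i) (π j)) : Quotient s → Quotient t :=
  Quotient.map π h

lemma rk_eq {n : ℕ} {π : Equiv.Perm (Fin n)} {s t : Setoid (Fin n)} (h : Carries π s t) :
    rk t = rk s := by
  unfold rk
  congr 1
  exact (Nat.card_congr (Quotient.congr π h)).symm

/-- For `r ≤ s`, the map of blocks inducing the inclusion of the layer of `s` in that of `r`. -/
def coarsen {n : ℕ} {r s : Setoid (Fin n)} (h : r ≤ s) : Quotient r → Quotient s :=
  blockMap 1 fun _ _ hij => h hij

lemma coarsen_surjective {n : ℕ} {r s : Setoid (Fin n)} (h : r ≤ s) :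
    Function.Surjective (coarsen h) := by
  intro b
  induction b using Quotient.inductionOn with
  | h i => exact ⟨Quotient.mk r i, rfl⟩

lemma card_le {n : ℕ} (s : Setoid (Fin n)) : Nat.card (Quotient s) ≤ n := by
  simpa using Nat.card_le_card_of_surjective (Quotient.mk s) Quotient.mk_surjective

lemma exists_merged {n : ℕ} {r s : Setoid (Fin n)} (hrk : rk s = rk r + 1) :
    ∃ ij : Fin n × Fin n, s ij.1 ij.2 ∧ ¬ r ij.1 ij.2 := by
  by_contra! hcon
  have hsr : s ≤ r := fun {i j} hij => hcon (i, j) hij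
  have := Nat.card_le_card_of_surjective _ (coarsen_surjective hsr)
  have := card_le r
  have := card_le s
  unfold rk at hrk
  omega

lemma two_fibres {X Y : Type} [Finite X] (φ : X → Y) (hφ : Function.Surjective φ)
    (hc : Nat.card X = Nat.card Y + 1) {a b c d : X} (hab : a ≠ b) (hcd : c ≠ d)
    (h1 : φ a = φ b) (h2 : φ c = φ d) : (c = a ∧ d = b) ∨ (c = b ∧ d = a) := by
  classical
  have key : ∀ a b : X, a ≠ b → φ a = φ b → a = c ∨ a = d := by
    intro a b hab h1
    by_contra! hcon
    have : Finite Y := Finite.of_surjective φ hφ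
    let ψ : {x : X // x ≠ a} → Y := fun x => φ x.1
    have hψ : Function.Surjective ψ := by
      intro y
      obtain ⟨x, rfl⟩ := hφ y
      by_cases hx : x = a
      · exact ⟨⟨b, hab.symm⟩, by simp [ψ, hx, h1]⟩
      · exact ⟨⟨x, hx⟩, rfl⟩
    have hcard : Nat.card {x : X // x ≠ a} + 1 = Nat.card X := by
      have := Fintype.ofFinite X
      rw [Nat.card_eq_fintype_card, Nat.card_eq_fintype_card]
      have h3 := Fintype.card_subtype_compl (fun x : X => x = a)
      have h4 : 0 < Fintype.card X := Fintype.card_pos_iff.mpr ⟨a⟩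
      simp only [Fintype.card_unique] at h3
      simp only [ne_eq]
      omega
    have hinj : Function.Injective ψ :=
      (hψ.bijective_of_nat_card_le (by omega)).injective
    have := @hinj ⟨c, hcon.1.symm⟩ ⟨d, hcon.2.symm⟩ h2
    exact hcd (by simpa using this)
  have ha := key a b hab h1
  have hb := key b a hab.symm h1.symm
  grind

/-! ### Gysin maps -/

/-- A coordinate of each block of `s`, as a block of `r`; for `r ≤ s` this is a section of
`coarsen`, so that it induces a retraction of the layer of `r` on the layer of `s`. -/
def blockSection {n : ℕ} (r s : Setoid (Fin n)) : Quotient s → Quotient r :=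
  fun b => Quotient.mk r b.out

lemma coarsen_blockSection {n : ℕ} {r s : Setoid (Fin n)} (h : r ≤ s) :
    coarsen h ∘ blockSection r s = id := by
  funext b
  exact Quotient.out_eq b

lemma mul_mem_two {M : Type*} [AddCommGroup M] [Module ℚ M] (p : ℕ) (u v : M)
    (a : ExteriorAlgebra ℚ M) (ha : a ∈ ⋀[ℚ]^p M) :
    a * (ExteriorAlgebra.ι ℚ u * ExteriorAlgebra.ι ℚ v) ∈ ⋀[ℚ]^(p + 2) M := by
  rw [← mul_assoc]
  change _ ∈ LinearMap.range (ExteriorAlgebra.ι ℚ : M →ₗ[ℚ] _) ^ (p + 2)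
  rw [pow_succ, pow_succ]
  exact Submodule.mul_mem_mul (Submodule.mul_mem_mul ha ⟨u, rfl⟩) ⟨v, rfl⟩

/-- The Gysin map `H^p(W_s/E) → H^{p+2}(W_r/E)` of the inclusion `W_s ⊂ W_r` of a divisor.
If `ρ^* : H(W_s/E) → H(W_r/E)` is a right inverse of the restriction, then by the projection
formula it is `a ↦ ρ^*(a) · [W_s]`, where `W_s` is the divisor `P_i = P_j` of `W_r` for any pair
`i, j` related by `s` and not by `r`. See `gysin_restrict`. -/
def gysin {n : ℕ} (p : ℕ) {r s : Setoid (Fin n)} (hrk : rk s = rk r + 1) :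
    ⋀[ℚ]^p (H1 Λ (Quotient s)) →ₗ[ℚ] ⋀[ℚ]^(p + 2) (H1 Λ (Quotient r)) :=
  (LinearMap.mulRight ℚ (divisorClass (Λ := Λ)
    (Quotient.mk r (exists_merged hrk).choose.1)
    (Quotient.mk r (exists_merged hrk).choose.2))).restrict (fun a ha => mul_mem_two p _ _ a ha)
  ∘ₗ exteriorPower.map p (H1map LinearMap.id (blockSection r s))

lemma exteriorPower_map_coe {M N : Type*} [AddCommGroup M] [Module ℚ M] [AddCommGroup N]
    [Module ℚ N] (p : ℕ) (f : M →ₗ[ℚ] N) (a : ⋀[ℚ]^p M) :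
    (exteriorPower.map p f a : ExteriorAlgebra ℚ N) = ExteriorAlgebra.map f a := by
  have : (⋀[ℚ]^p N).subtype ∘ₗ exteriorPower.map p f =
      (ExteriorAlgebra.map f).toLinearMap ∘ₗ (⋀[ℚ]^p M).subtype := by
    apply exteriorPower.linearMap_ext
    ext m
    simp [exteriorPower.map_apply_ιMulti, exteriorPower.ιMulti_apply_coe,
      ExteriorAlgebra.map_apply_ιMulti]
  exact LinearMap.congr_fun this a

lemma divisorClass_merged {n : ℕ} {r s : Setoid (Fin n)} (hrs : r ≤ s) (hrk : rk s = rk r + 1)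
    {i j k l : Fin n} (h1 : s i j) (h2 : ¬ r i j) (h3 : s k l) (h4 : ¬ r k l) :
    divisorClass (Λ := Λ) (Quotient.mk r i) (Quotient.mk r j) =
      divisorClass (Quotient.mk r k) (Quotient.mk r l) := by
  have hc : Nat.card (Quotient r) = Nat.card (Quotient s) + 1 := by
    have := card_le r
    have := card_le s
    unfold rk at hrk
    omega
  rcases two_fibres (coarsen hrs) (coarsen_surjective hrs) hc
    (a := Quotient.mk r k) (b := Quotient.mk r l) (c := Quotient.mk r i) (d := Quotient.mk r j)
    (fun h => h4 (Quotient.exact h)) (fun h => h2 (Quotient.exact h))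
    (Quotient.sound h3) (Quotient.sound h1) with ⟨h, h'⟩ | ⟨h, h'⟩
  · rw [h, h']
  · rw [h, h', divisorClass_swap]

lemma delta_mul_divisorClass {X : Type} (b c : X) (h : H1E Λ) :
    ExteriorAlgebra.ι ℚ (delta b c h) * divisorClass b c = 0 := by
  have hh : h = (xyBasis Λ).repr h 0 • xyBasis Λ 0 + (xyBasis Λ).repr h 1 • xyBasis Λ 1 := by
    conv_lhs => rw [← (xyBasis Λ).sum_repr h, Fin.sum_univ_two]
  rw [hh, map_add, map_smul, map_smul, map_add, map_smul, map_smul, divisorClass]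
  generalize delta b c (xyBasis Λ 0) = u
  generalize delta b c (xyBasis Λ 1) = v
  have hvu : ExteriorAlgebra.ι ℚ v * ExteriorAlgebra.ι ℚ u =
      - (ExteriorAlgebra.ι ℚ u * ExteriorAlgebra.ι ℚ v) :=
    eq_neg_of_add_eq_zero_left (ExteriorAlgebra.ι_add_mul_swap v u)
  rw [add_mul, smul_mul_assoc, smul_mul_assoc, ← mul_assoc, ← mul_assoc, hvu,
    ExteriorAlgebra.ι_sq_zero, neg_mul, mul_assoc, ExteriorAlgebra.ι_sq_zero]
  simp

lemma ι_comm_divisorClass {X : Type} (b c : X) (w : H1 Λ X) :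
    ExteriorAlgebra.ι ℚ w * divisorClass b c = divisorClass b c * ExteriorAlgebra.ι ℚ w := by
  have hs : ∀ u v : H1 Λ X, ExteriorAlgebra.ι ℚ v * ExteriorAlgebra.ι ℚ u =
      - (ExteriorAlgebra.ι ℚ u * ExteriorAlgebra.ι ℚ v) := fun u v =>
    eq_neg_of_add_eq_zero_left (ExteriorAlgebra.ι_add_mul_swap v u)
  rw [divisorClass, ← mul_assoc, hs _ w, neg_mul, mul_assoc, hs _ w, mul_neg, neg_neg, mul_assoc]

lemma map_section_mul {n : ℕ} {r s : Setoid (Fin n)} (hrs : r ≤ s) (hrk : rk s = rk r + 1)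
    {i j : Fin n} (h1 : s i j) (h2 : ¬ r i j) (a : ExteriorAlgebra ℚ (H1 Λ (Quotient r))) :
    ExteriorAlgebra.map (H1map LinearMap.id (blockSection r s ∘ coarsen hrs)) a *
      divisorClass (Quotient.mk r i) (Quotient.mk r j) =
    a * divisorClass (Quotient.mk r i) (Quotient.mk r j) := by
  set D := divisorClass (Λ := Λ) (Quotient.mk r i) (Quotient.mk r j) with hD
  have hlin : ∀ w : H1 Λ (Quotient r),
      ExteriorAlgebra.ι ℚ (H1map LinearMap.id (blockSection r s ∘ coarsen hrs) w) * D =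
      ExteriorAlgebra.ι ℚ w * D := by
    have hspan : ∀ f : Quotient r →₀ H1E Λ, ∃ w' : H1 Λ (Quotient r),
        (w' : Quotient r →₀ H1E Λ) =
          Finsupp.mapDomain (blockSection r s ∘ coarsen hrs) f - f ∧
        ExteriorAlgebra.ι ℚ w' * D = 0 := by
      intro f
      induction f using Finsupp.induction_linear with
      | zero => exact ⟨0, by simp, by simp⟩
      | add f g hf hg =>
        obtain ⟨w1, e1, m1⟩ := hf
        obtain ⟨w2, e2, m2⟩ := hg
        refine ⟨w1 + w2, ?_, ?_⟩
        · rw [Submodule.coe_add, e1, e2, Finsupp.mapDomain_add]; abel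
        · rw [map_add, add_mul, m1, m2, add_zero]
      | single b h =>
        refine ⟨delta (blockSection r s (coarsen hrs b)) b h, ?_, ?_⟩
        · rw [delta_coe, Finsupp.mapDomain_single]; rfl
        · induction b using Quotient.inductionOn with
          | h k =>
            change ExteriorAlgebra.ι ℚ (delta (Quotient.mk r
              (coarsen hrs (Quotient.mk r k)).out) (Quotient.mk r k) h) * D = 0
            set k' := (coarsen hrs (Quotient.mk r k)).out with hk'
            have hs : s k' k := Quotient.exact (Quotient.out_eq (coarsen hrs (Quotient.mk r k)))
            by_cases hr : r k' k
            · have : Quotient.mk r k' = Quotient.mk r k := Quotient.sound hr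
              have h0 : delta (Quotient.mk r k') (Quotient.mk r k) h = 0 := by
                apply Subtype.ext; rw [delta_coe, this]; simp
              rw [h0, map_zero, zero_mul]
            · rw [hD, divisorClass_merged hrs hrk h1 h2 hs hr, delta_mul_divisorClass]
    intro w
    obtain ⟨w', e, m⟩ := hspan w
    have : H1map LinearMap.id (blockSection r s ∘ coarsen hrs) w = w + w' := by
      apply Subtype.ext
      rw [Submodule.coe_add, e, H1map_coe]
      simp
    rw [this, map_add, add_mul, m, add_zero]
  induction a using ExteriorAlgebra.induction with
  | algebraMap c => rw [AlgHom.commutes]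
  | ι w => rw [ExteriorAlgebra.map_apply_ι, hlin]
  | add a b ha hb => rw [map_add, add_mul, add_mul, ha, hb]
  | mul a b ha hb =>
    have hcomm : ∀ a : ExteriorAlgebra ℚ (H1 Λ (Quotient r)), a * D = D * a := by
      intro a
      induction a using ExteriorAlgebra.induction with
      | algebraMap c => exact Algebra.commutes c D
      | ι w => exact ι_comm_divisorClass _ _ w
      | add a b ha hb => rw [add_mul, mul_add, ha, hb]
      | mul a b ha hb => rw [mul_assoc, hb, ← mul_assoc, ha, mul_assoc]
    rw [map_mul, mul_assoc, hb, hcomm b, ← mul_assoc, ha, mul_assoc, ← hcomm b, mul_assoc]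

lemma restrict_surjective {n : ℕ} {r s : Setoid (Fin n)} (hrs : r ≤ s) (p : ℕ) :
    Function.Surjective (exteriorPower.map p
      (H1map (Λ := Λ) LinearMap.id (coarsen hrs))) := by
  intro a
  refine ⟨exteriorPower.map p (H1map LinearMap.id (blockSection r s)) a, ?_⟩
  rw [← LinearMap.comp_apply, ← exteriorPower.map_comp, H1map_comp, coarsen_blockSection,
    LinearMap.comp_id, H1map_id, exteriorPower.map_id, LinearMap.id_apply]

/-- The Gysin map is characterized by `G(γ^* a) = a · [W_s]`, where `γ^*` is the (surjective)
restriction from `W_r` to `W_s`. -/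
lemma gysin_restrict {n : ℕ} (p : ℕ) {r s : Setoid (Fin n)} (hrs : r ≤ s)
    (hrk : rk s = rk r + 1) {i j : Fin n} (h1 : s i j) (h2 : ¬ r i j)
    (a : ⋀[ℚ]^p (H1 Λ (Quotient r))) :
    (gysin p hrk (exteriorPower.map p (H1map LinearMap.id (coarsen hrs)) a) :
      ExteriorAlgebra ℚ (H1 Λ (Quotient r))) =
    (a : ExteriorAlgebra ℚ (H1 Λ (Quotient r))) *
      divisorClass (Quotient.mk r i) (Quotient.mk r j) := by
  obtain ⟨c1, c2⟩ := (exists_merged hrk).choose_spec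
  rw [divisorClass_merged hrs hrk h1 h2 c1 c2, ← map_section_mul hrs hrk c1 c2]
  change ((exteriorPower.map p (H1map LinearMap.id (blockSection r s))
    (exteriorPower.map p (H1map LinearMap.id (coarsen hrs)) a) :
      ⋀[ℚ]^p (H1 Λ (Quotient r))) : ExteriorAlgebra ℚ (H1 Λ (Quotient r))) * _ = _
  congr 1
  rw [← LinearMap.comp_apply, ← exteriorPower.map_comp, H1map_comp, exteriorPower_map_coe,
    LinearMap.comp_id]

lemma gysin_equivariant {n : ℕ} (p : ℕ) (A : SL2) (π : Equiv.Perm (Fin n))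
    {r s r' s' : Setoid (Fin n)} (hrs : r ≤ s) (hrs' : r' ≤ s')
    (hrk : rk s = rk r + 1) (hrk' : rk s' = rk r' + 1)
    (hr : Carries π r r') (hs : Carries π s s') (a : ⋀[ℚ]^p (H1 Λ (Quotient s))) :
    gysin p hrk' (exteriorPower.map p
      (H1map (slRep Λ A) (blockMap π fun i j => (hs i j).1)) a) =
    exteriorPower.map (p + 2) (H1map (slRep Λ A) (blockMap π fun i j => (hr i j).1))
      (gysin p hrk a) := by
  obtain ⟨a, rfl⟩ := restrict_surjective hrs p a
  obtain ⟨⟨i, j⟩, h1, h2⟩ := exists_merged hrk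
  apply Subtype.ext
  rw [exteriorPower_map_coe, gysin_restrict p hrs hrk h1 h2, map_mul, map_divisorClass]
  have e : (blockMap π fun i j => (hs i j).1) ∘ coarsen hrs =
      coarsen hrs' ∘ (blockMap π fun i j => (hr i j).1) := by
    funext b
    induction b using Quotient.inductionOn with
    | h k => rfl
  have e2 : exteriorPower.map p (H1map (slRep Λ A) (blockMap π fun i j => (hs i j).1))
      (exteriorPower.map p (H1map LinearMap.id (coarsen hrs)) a) =
      exteriorPower.map p (H1map LinearMap.id (coarsen hrs'))
        (exteriorPower.map p (H1map (slRep Λ A) (blockMap π fun i j => (hr i j).1)) a) := by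
    rw [← LinearMap.comp_apply, ← LinearMap.comp_apply, ← exteriorPower.map_comp,
      ← exteriorPower.map_comp, H1map_comp, H1map_comp, LinearMap.id_comp, LinearMap.comp_id, e]
  rw [e2, gysin_restrict p hrs' hrk' (i := π i) (j := π j) ((hs i j).1 h1)
      (fun h => h2 ((hr i j).2 h)), exteriorPower_map_coe]
  rfl

/-! ### Cohomology of the local hyperplane arrangements -/

/-- The hyperplanes of the local arrangement at the layer `s`: the unordered pairs `{i, j}` of
distinct coordinates such that the divisor `P_i = P_j` contains the layer. -/
def IsEdge {n : ℕ} (s : Setoid (Fin n)) (e : Sym2 (Fin n)) : Prop :=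
  ∃ i j, i ≠ j ∧ s i j ∧ e = s(i, j)

lemma isEdge_mk {n : ℕ} {s : Setoid (Fin n)} {i j : Fin n} :
    IsEdge s s(i, j) ↔ i ≠ j ∧ s i j := by
  constructor
  · rintro ⟨k, l, h1, h2, h3⟩
    rcases Sym2.eq_iff.mp h3 with ⟨rfl, rfl⟩ | ⟨rfl, rfl⟩
    · exact ⟨h1, h2⟩
    · exact ⟨h1.symm, s.symm h2⟩
  · exact fun h => ⟨i, j, h.1, h.2, rfl⟩

abbrev Edge {n : ℕ} (s : Setoid (Fin n)) : Type := {e : Sym2 (Fin n) // IsEdge s e}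

/-- The exterior algebra on generators `ω_e`, one for each hyperplane `e` of the local arrangement
at the layer `s`. -/
abbrev FreeOS {n : ℕ} (s : Setoid (Fin n)) : Type := ExteriorAlgebra ℚ (Edge s →₀ ℚ)

open scoped Classical in
/-- The basis vector of `e` if `e` is a hyperplane of the local arrangement at `s`,
and `0` otherwise. -/
def edgeVec {n : ℕ} (s : Setoid (Fin n)) (e : Sym2 (Fin n)) : Edge s →₀ ℚ :=
  if h : IsEdge s e then Finsupp.single ⟨e, h⟩ 1 else 0

/-- The generator `ω_{ij} = ω_{ji}` if `i ≠ j` are in the same block of `s`, and `0` otherwise. -/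
def gen {n : ℕ} (s : Setoid (Fin n)) (i j : Fin n) : FreeOS s :=
  ExteriorAlgebra.ι ℚ (edgeVec s s(i, j))

/-- The relation `ω_{ij} ω_{jk} + ω_{jk} ω_{ki} + ω_{ki} ω_{ij} = 0`; it is trivial unless
`i, j, k` are distinct coordinates of one block. -/
def arnold {n : ℕ} (s : Setoid (Fin n)) (i j k : Fin n) : FreeOS s :=
  gen s i j * gen s j k + gen s j k * gen s k i + gen s k i * gen s i j

/-- The ideal of relations. (The left ideal generated by the homogeneous elements `arnold s i j k`
is a two-sided ideal.) -/
def OSideal {n : ℕ} (s : Setoid (Fin n)) : Submodule ℚ (FreeOS s) :=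
  (Ideal.span {x | ∃ i j k, x = arnold s i j k}).restrictScalars ℚ

/-- `H^q` of the complement of the local hyperplane arrangement at the layer `s` (a product of
braid hyperplane arrangements), with rational coefficients: the component of degree `q` of its
Orlik-Solomon algebra. -/
def OS {n : ℕ} (s : Setoid (Fin n)) (q : ℕ) : Submodule ℚ (FreeOS s ⧸ OSideal s) :=
  (⋀[ℚ]^q (Edge s →₀ ℚ)).map (OSideal s).mkQ

/-- On generators, `ω_e ↦ ω_{π e}` if `π e` is a hyperplane of the local arrangement at `t`,
and `ω_e ↦ 0` otherwise. -/
def edgeMap {n : ℕ} (π : Equiv.Perm (Fin n)) (s t : Setoid (Fin n)) :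
    (Edge s →₀ ℚ) →ₗ[ℚ] (Edge t →₀ ℚ) :=
  Finsupp.linearCombination ℚ fun e => edgeVec t (e.1.map π)

lemma edgeVec_coe {n : ℕ} {s : Setoid (Fin n)} (e : Edge s) :
    edgeVec s e.1 = Finsupp.single e 1 := by
  rw [edgeVec, dif_pos e.2]

lemma edgeVec_of_not {n : ℕ} {s : Setoid (Fin n)} {e : Sym2 (Fin n)} (h : ¬ IsEdge s e) :
    edgeVec s e = 0 := by
  rw [edgeVec, dif_neg h]

lemma edgeMap_single {n : ℕ} (π : Equiv.Perm (Fin n)) (s t : Setoid (Fin n)) (e : Edge s)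
    (c : ℚ) : edgeMap π s t (Finsupp.single e c) = c • edgeVec t (e.1.map π) :=
  Finsupp.linearCombination_single _ _ _

lemma isEdge_of_map {n : ℕ} {π : Equiv.Perm (Fin n)} {s t : Setoid (Fin n)}
    (h : ∀ i j, t (π i) (π j) → s i j) {e : Sym2 (Fin n)} (he : IsEdge t (e.map π)) :
    IsEdge s e := by
  induction e using Sym2.inductionOn with
  | hf i j =>
    rw [Sym2.map_mk, isEdge_mk] at he
    exact isEdge_mk.2 ⟨fun e => he.1 (by rw [e]), h _ _ he.2⟩

lemma edgeMap_edgeVec {n : ℕ} (π : Equiv.Perm (Fin n)) {s t : Setoid (Fin n)}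
    (h : ∀ i j, t (π i) (π j) → s i j) (e : Sym2 (Fin n)) :
    edgeMap π s t (edgeVec s e) = edgeVec t (e.map π) := by
  by_cases he : IsEdge s e
  · rw [edgeVec_coe ⟨e, he⟩, edgeMap_single, one_smul]
  · rw [edgeVec_of_not he, edgeVec_of_not fun h' => he (isEdge_of_map h h'), map_zero]

lemma edgeMap_comp {n : ℕ} (π ρ : Equiv.Perm (Fin n)) (s t u : Setoid (Fin n))
    (h : ∀ i j, u (ρ i) (ρ j) → t i j) :
    edgeMap ρ t u ∘ₗ edgeMap π s t = edgeMap (ρ * π) s u := by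
  apply Finsupp.lhom_ext
  intro e c
  rw [LinearMap.comp_apply, edgeMap_single, edgeMap_single, map_smul, edgeMap_edgeVec ρ h,
    Sym2.map_map]
  rfl

lemma edgeMap_one {n : ℕ} (s : Setoid (Fin n)) : edgeMap 1 s s = LinearMap.id := by
  apply Finsupp.lhom_ext
  intro e c
  rw [edgeMap_single, Equiv.Perm.coe_one, Sym2.map_id, id, edgeVec_coe]
  simp

lemma map_gen {n : ℕ} (π : Equiv.Perm (Fin n)) {s t : Setoid (Fin n)}
    (h : ∀ i j, t (π i) (π j) → s i j) (i j : Fin n) :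
    ExteriorAlgebra.map (edgeMap π s t) (gen s i j) = gen t (π i) (π j) := by
  rw [gen, ExteriorAlgebra.map_apply_ι, edgeMap_edgeVec π h, Sym2.map_mk]; rfl

lemma OSideal_le_map {n : ℕ} (π : Equiv.Perm (Fin n)) {s t : Setoid (Fin n)}
    (h : ∀ i j, t (π i) (π j) → s i j) :
    OSideal s ≤ (OSideal t).comap (ExteriorAlgebra.map (edgeMap π s t)).toLinearMap := by
  intro x hx
  have hx' : x ∈ Ideal.span {x | ∃ i j k, x = arnold s i j k} := hx
  change ExteriorAlgebra.map (edgeMap π s t) x ∈ Ideal.span {x | ∃ i j k, x = arnold t i j k}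
  clear hx
  induction hx' using Submodule.span_induction with
  | mem x hx =>
    obtain ⟨i, j, k, rfl⟩ := hx
    apply Ideal.subset_span
    refine ⟨π i, π j, π k, ?_⟩
    simp only [arnold, map_add, map_mul, map_gen π h]
  | zero => simp
  | add x y hx hy h1 h2 => rw [map_add]; exact add_mem h1 h2
  | smul a x hx h1 =>
    rw [smul_eq_mul, map_mul]
    exact Ideal.mul_mem_left _ _ h1

/-- The map `ω_e ↦ ω_{π e}` (or `0`) on Orlik-Solomon algebras. It is used for `t` the image of `s`
under `π`, and for `π = 1` and `t ≤ s`; in the second case it is the projection of the cohomology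
of the local arrangement at `s` on that of its localization at `t`. -/
def quotMap {n : ℕ} (π : Equiv.Perm (Fin n)) {s t : Setoid (Fin n)}
    (h : ∀ i j, t (π i) (π j) → s i j) : (FreeOS s ⧸ OSideal s) →ₗ[ℚ] (FreeOS t ⧸ OSideal t) :=
  (OSideal s).mapQ (OSideal t) (ExteriorAlgebra.map (edgeMap π s t)).toLinearMap
    (OSideal_le_map π h)

lemma quotMap_mem {n : ℕ} (π : Equiv.Perm (Fin n)) {s t : Setoid (Fin n)}
    (h : ∀ i j, t (π i) (π j) → s i j) (q : ℕ) :
    ∀ x ∈ OS s q, quotMap π h x ∈ OS t q := by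
  rintro _ ⟨x, hx, rfl⟩
  refine ⟨ExteriorAlgebra.map (edgeMap π s t) x, ?_, rfl⟩
  have := (exteriorPower.map q (edgeMap π s t) ⟨x, hx⟩).2
  rwa [exteriorPower_map_coe] at this

def osMap {n : ℕ} (π : Equiv.Perm (Fin n)) {s t : Setoid (Fin n)}
    (h : ∀ i j, t (π i) (π j) → s i j) (q : ℕ) : OS s q →ₗ[ℚ] OS t q :=
  (quotMap π h).restrict (quotMap_mem π h q)

/-- The functional with value `1` on every generator. -/
def total {n : ℕ} (s : Setoid (Fin n)) : Module.Dual ℚ (Edge s →₀ ℚ) :=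
  Finsupp.linearCombination ℚ fun _ => (1 : ℚ)

/-- The derivation with `∂ ω_e = 1`, that is
`∂ (ω_{e_1} ⋯ ω_{e_q}) = ∑_k (-1)^(k-1) ω_{e_1} ⋯ (omit ω_{e_k}) ⋯ ω_{e_q}`. -/
def bdry {n : ℕ} (s : Setoid (Fin n)) : FreeOS s →ₗ[ℚ] FreeOS s :=
  CliffordAlgebra.contractLeft (Q := 0) (total s)

lemma bdry_ι_mul {n : ℕ} (s : Setoid (Fin n)) (v : Edge s →₀ ℚ) (x : FreeOS s) :
    bdry s (ExteriorAlgebra.ι ℚ v * x) =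
      total s v • x - ExteriorAlgebra.ι ℚ v * bdry s x :=
  CliffordAlgebra.contractLeft_ι_mul _ _ _

lemma bdry_algebraMap {n : ℕ} (s : Setoid (Fin n)) (c : ℚ) :
    bdry s (algebraMap ℚ (FreeOS s) c) = 0 :=
  CliffordAlgebra.contractLeft_algebraMap (Q := (0 : QuadraticForm ℚ (Edge s →₀ ℚ))) _ c

lemma total_edgeVec {n : ℕ} {s : Setoid (Fin n)} {i j : Fin n} (hij : i ≠ j) (h : s i j) :
    total s (edgeVec s s(i, j)) = 1 := by
  rw [edgeVec_coe ⟨_, isEdge_mk.2 ⟨hij, h⟩⟩]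
  simp [total]

lemma gen_of_not {n : ℕ} {s : Setoid (Fin n)} {i j : Fin n} (h : ¬ s i j) : gen s i j = 0 := by
  rw [gen, edgeVec_of_not fun h' => h (isEdge_mk.1 h').2, map_zero]

lemma gen_self {n : ℕ} (s : Setoid (Fin n)) (i : Fin n) : gen s i i = 0 := by
  rw [gen, edgeVec_of_not fun h' => (isEdge_mk.1 h').1 rfl, map_zero]

lemma gen_comm {n : ℕ} (s : Setoid (Fin n)) (i j : Fin n) : gen s i j = gen s j i := by
  rw [gen, Sym2.eq_swap]; rfl

lemma gen_sq {n : ℕ} (s : Setoid (Fin n)) (i j : Fin n) : gen s i j * gen s i j = 0 :=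
  ExteriorAlgebra.ι_sq_zero _

lemma bdry_arnold {n : ℕ} (s : Setoid (Fin n)) (i j k : Fin n) :
    bdry s (arnold s i j k) = 0 := by
  have hmul : ∀ u v : Edge s →₀ ℚ, total s u = 1 → total s v = 1 →
      bdry s (ExteriorAlgebra.ι ℚ u * ExteriorAlgebra.ι ℚ v) =
      ExteriorAlgebra.ι ℚ v - ExteriorAlgebra.ι ℚ u := by
    intro u v hu hv
    have h1 : bdry s (ExteriorAlgebra.ι ℚ v) = 1 := by
      have := bdry_ι_mul s v 1
      rw [mul_one, hv, one_smul, ← map_one (algebraMap ℚ (FreeOS s)), bdry_algebraMap,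
        mul_zero, sub_zero, map_one] at this
      exact this
    rw [bdry_ι_mul, hu, one_smul, h1, mul_one]
  by_cases hij : i = j
  · subst hij
    rw [arnold, gen_self, gen_comm s k i, gen_sq]; simp
  by_cases hjk : j = k
  · subst hjk
    rw [arnold, gen_self, gen_comm s j i, gen_sq]; simp
  by_cases hki : k = i
  · subst hki
    rw [arnold, gen_self, gen_comm s j k, gen_sq]; simp
  by_cases h1 : s i j
  · by_cases h2 : s j k
    · have ha := total_edgeVec hij h1
      have hb := total_edgeVec hjk h2
      have hc := total_edgeVec hki (s.symm (s.trans h1 h2))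
      rw [arnold, gen, gen, gen, map_add, map_add, hmul _ _ ha hb, hmul _ _ hb hc,
        hmul _ _ hc ha]
      abel
    · have h3 : ¬ s k i := fun h => h2 (s.symm (s.trans h h1))
      rw [arnold, gen_of_not h2, gen_of_not h3]; simp
  · by_cases h2 : s j k
    · have h3 : ¬ s k i := fun h => h1 (s.symm (s.trans h2 h))
      rw [arnold, gen_of_not h1, gen_of_not h3]; simp
    · rw [arnold, gen_of_not h1, gen_of_not h2]; simp

lemma OSideal_le_bdry {n : ℕ} (s : Setoid (Fin n)) :
    OSideal s ≤ (OSideal s).comap (bdry s) := by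
  intro x hx
  have hx' : x ∈ Ideal.span {x | ∃ i j k, x = arnold s i j k} := hx
  change bdry s x ∈ Ideal.span {x | ∃ i j k, x = arnold s i j k}
  clear hx
  induction hx' using Submodule.span_induction with
  | mem x hx =>
    obtain ⟨i, j, k, rfl⟩ := hx
    rw [bdry_arnold]
    exact zero_mem _
  | zero => simp
  | add x y hx hy h1 h2 => rw [map_add]; exact add_mem h1 h2
  | smul a x hx h1 =>
    rw [smul_eq_mul]
    have gen_case : ∀ (a x : FreeOS s), x ∈ Ideal.span {x | ∃ i j k, x = arnold s i j k} →
        bdry s x ∈ Ideal.span {x | ∃ i j k, x = arnold s i j k} →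
        bdry s (a * x) ∈ Ideal.span {x | ∃ i j k, x = arnold s i j k} := by
      intro a
      induction a using ExteriorAlgebra.induction with
      | algebraMap c =>
        intro x hx h1
        rw [← Algebra.smul_def, map_smul, Algebra.smul_def]
        exact Ideal.mul_mem_left _ _ h1
      | ι v =>
        intro x hx h1
        rw [bdry_ι_mul, Algebra.smul_def]
        exact sub_mem (Ideal.mul_mem_left _ _ hx) (Ideal.mul_mem_left _ _ h1)
      | add a b ha hb =>
        intro x hx h1
        rw [add_mul, map_add]
        exact add_mem (ha x hx h1) (hb x hx h1)
      | mul a b ha hb =>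
        intro x hx h1
        rw [mul_assoc]
        exact ha _ (Ideal.mul_mem_left _ _ hx) (hb x hx h1)
    exact gen_case a x hx h1

lemma bdry_mem {n : ℕ} (s : Setoid (Fin n)) (q : ℕ) :
    ∀ x ∈ ⋀[ℚ]^(q + 1) (Edge s →₀ ℚ), bdry s x ∈ ⋀[ℚ]^q (Edge s →₀ ℚ) := by
  induction q with
  | zero =>
    intro x hx
    change x ∈ LinearMap.range (ExteriorAlgebra.ι ℚ : (Edge s →₀ ℚ) →ₗ[ℚ] _) ^ 1 at hx
    change _ ∈ LinearMap.range (ExteriorAlgebra.ι ℚ : (Edge s →₀ ℚ) →ₗ[ℚ] _) ^ 0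
    rw [pow_one] at hx
    obtain ⟨v, rfl⟩ := hx
    have := bdry_ι_mul s v 1
    rw [mul_one, ← map_one (algebraMap ℚ (FreeOS s)), bdry_algebraMap, mul_zero, sub_zero,
      map_one] at this
    rw [this, pow_zero]
    exact Submodule.smul_mem _ _ (Submodule.one_le.mp le_rfl)
  | succ q ih =>
    intro x hx
    change x ∈ LinearMap.range (ExteriorAlgebra.ι ℚ : (Edge s →₀ ℚ) →ₗ[ℚ] _) ^ (q + 1 + 1) at hx
    change _ ∈ LinearMap.range (ExteriorAlgebra.ι ℚ : (Edge s →₀ ℚ) →ₗ[ℚ] _) ^ (q + 1)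
    rw [pow_succ'] at hx
    induction hx using Submodule.mul_induction_on' with
    | mem_mul_mem m hm y hy =>
      obtain ⟨v, rfl⟩ := hm
      rw [bdry_ι_mul]
      refine sub_mem (Submodule.smul_mem _ _ hy) ?_
      rw [pow_succ']
      exact Submodule.mul_mem_mul ⟨v, rfl⟩ (ih y hy)
    | add x _ y _ h1 h2 => rw [map_add]; exact add_mem h1 h2

/-- The map `∂` on the Orlik-Solomon algebra. -/
def quotBdry {n : ℕ} (s : Setoid (Fin n)) : (FreeOS s ⧸ OSideal s) →ₗ[ℚ] (FreeOS s ⧸ OSideal s) :=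
  (OSideal s).mapQ (OSideal s) (bdry s) (OSideal_le_bdry s)

lemma quotBdry_mem {n : ℕ} (s : Setoid (Fin n)) (q : ℕ) :
    ∀ x ∈ OS s (q + 1), quotBdry s x ∈ OS s q := by
  rintro _ ⟨x, hx, rfl⟩
  exact ⟨bdry s x, bdry_mem s q x hx, rfl⟩

/-- The component `σ_r : H^{q+1}(M(A_s)) → H^q(M(A_r))`, for `r ≤ s`, of the differential `∂` of
the cohomology of the local arrangement at `s`. -/
def sigma {n : ℕ} (q : ℕ) {r s : Setoid (Fin n)} (hrs : r ≤ s) : OS s (q + 1) →ₗ[ℚ] OS r q :=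
  osMap 1 (fun _ _ h => hrs h) q ∘ₗ (quotBdry s).restrict (quotBdry_mem s q)

lemma bdry_map {n : ℕ} {π : Equiv.Perm (Fin n)} {s t : Setoid (Fin n)} (h : Carries π s t)
    (x : FreeOS s) :
    bdry t (ExteriorAlgebra.map (edgeMap π s t) x) =
      ExteriorAlgebra.map (edgeMap π s t) (bdry s x) := by
  have ht : ∀ v, total t (edgeMap π s t v) = total s v := by
    intro v
    induction v using Finsupp.induction_linear with
    | zero => simp
    | add v w hv hw => rw [map_add, map_add, map_add, hv, hw]
    | single e c =>
      obtain ⟨e, i, j, hij, hs, rfl⟩ := e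
      rw [edgeMap_single, map_smul, Sym2.map_mk,
        total_edgeVec (fun e => hij (π.injective e)) ((h i j).1 hs)]
      simp [total]
  have key : ∀ (a x : FreeOS s), bdry t (ExteriorAlgebra.map (edgeMap π s t) x) =
      ExteriorAlgebra.map (edgeMap π s t) (bdry s x) →
      bdry t (ExteriorAlgebra.map (edgeMap π s t) (a * x)) =
      ExteriorAlgebra.map (edgeMap π s t) (bdry s (a * x)) := by
    intro a
    induction a using ExteriorAlgebra.induction with
    | algebraMap c =>
      intro x hx
      rw [← Algebra.smul_def, map_smul, map_smul, map_smul, map_smul, hx]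
    | ι v =>
      intro x hx
      rw [map_mul, ExteriorAlgebra.map_apply_ι, bdry_ι_mul, bdry_ι_mul, hx, ht, map_sub,
        map_mul, map_smul, ExteriorAlgebra.map_apply_ι]
    | add a b ha hb =>
      intro x hx
      rw [add_mul, map_add, map_add, map_add, map_add, ha x hx, hb x hx]
    | mul a b ha hb =>
      intro x hx
      rw [mul_assoc]
      exact ha _ (hb x hx)
  have := key x 1 (by
    rw [map_one, ← map_one (algebraMap ℚ (FreeOS s)), ← map_one (algebraMap ℚ (FreeOS t)),
      bdry_algebraMap, bdry_algebraMap, map_zero])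
  rwa [mul_one] at this

lemma sigma_equivariant {n : ℕ} (q : ℕ) (π : Equiv.Perm (Fin n))
    {r s r' s' : Setoid (Fin n)} (hrs : r ≤ s) (hrs' : r' ≤ s')
    (hr : Carries π r r') (hs : Carries π s s') (x : OS s (q + 1)) :
    sigma q hrs' (osMap π (fun i j => (hs i j).2) (q + 1) x) =
      osMap π (fun i j => (hr i j).2) q (sigma q hrs x) := by
  obtain ⟨_, x, hx, rfl⟩ := x
  apply Subtype.ext
  change (OSideal r').mkQ (ExteriorAlgebra.map (edgeMap 1 s' r')
      (bdry s' (ExteriorAlgebra.map (edgeMap π s s') x))) =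
    (OSideal r').mkQ (ExteriorAlgebra.map (edgeMap π r r')
      (ExteriorAlgebra.map (edgeMap 1 s r) (bdry s x)))
  rw [bdry_map hs, ← AlgHom.comp_apply, ← AlgHom.comp_apply, ExteriorAlgebra.map_comp_map,
    ExteriorAlgebra.map_comp_map, edgeMap_comp, edgeMap_comp, one_mul, mul_one]
  · exact fun i j h => (hr i j).2 h
  · exact fun i j h => hrs' h

lemma osMap_comp {n : ℕ} (q : ℕ) {π ρ : Equiv.Perm (Fin n)} {s t u : Setoid (Fin n)}
    (h : Carries π s t) (h' : Carries ρ t u) (x : OS s q) :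
    osMap ρ (fun i j => (h' i j).2) q (osMap π (fun i j => (h i j).2) q x) =
      osMap (ρ * π) (fun i j => ((h.trans h') i j).2) q x := by
  obtain ⟨_, x, hx, rfl⟩ := x
  apply Subtype.ext
  change (OSideal u).mkQ (ExteriorAlgebra.map (edgeMap ρ t u)
      (ExteriorAlgebra.map (edgeMap π s t) x)) =
    (OSideal u).mkQ (ExteriorAlgebra.map (edgeMap (ρ * π) s u) x)
  rw [← AlgHom.comp_apply, ExteriorAlgebra.map_comp_map, edgeMap_comp]
  exact fun i j hij => (h' i j).2 hij

lemma osMap_one {n : ℕ} (q : ℕ) {s : Setoid (Fin n)} (h : ∀ i j : Fin n,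
    s ((1 : Equiv.Perm (Fin n)) i) ((1 : Equiv.Perm (Fin n)) j) → s i j) (x : OS s q) :
    osMap 1 h q x = x := by
  obtain ⟨_, x, hx, rfl⟩ := x
  apply Subtype.ext
  change (OSideal s).mkQ (ExteriorAlgebra.map (edgeMap 1 s s) x) = (OSideal s).mkQ x
  rw [edgeMap_one, ExteriorAlgebra.map_id]; rfl

/-! ### The second and the third page -/

/-- The layers of rank `q`. -/
abbrev Layer (n q : ℕ) : Type := {s : Setoid (Fin n) // rk s = q}

instance (n : ℕ) : Finite (Setoid (Fin n)) :=
  Finite.of_injective (fun (s : Setoid (Fin n)) => (s : Fin n → Fin n → Prop))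
    fun _ _ h => Setoid.ext fun i j => iff_of_eq (congrFun (congrFun h i) j)

instance (n q : ℕ) : Fintype (Layer n q) := Fintype.ofFinite _

variable (Λ) in
/-- The summand `H^p(W_s/E) ⊗ H^q(M(A_s))` of the second page. -/
def Summand {n : ℕ} (p q : ℕ) (s : Setoid (Fin n)) : Type :=
  ⋀[ℚ]^p (H1 Λ (Quotient s)) ⊗[ℚ] OS s q

instance {n : ℕ} (p q : ℕ) (s : Setoid (Fin n)) : AddCommGroup (Summand Λ p q s) :=
  inferInstanceAs (AddCommGroup (⋀[ℚ]^p (H1 Λ (Quotient s)) ⊗[ℚ] OS s q))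

instance {n : ℕ} (p q : ℕ) (s : Setoid (Fin n)) : Module ℚ (Summand Λ p q s) :=
  inferInstanceAs (Module ℚ (⋀[ℚ]^p (H1 Λ (Quotient s)) ⊗[ℚ] OS s q))

/-- The summand `G_r ⊗ σ_r : H^p(W_s/E) ⊗ H^{q+1}(M(A_s)) → H^{p+2}(W_r/E) ⊗ H^q(M(A_r))` of the
differential, for a layer `r ≤ s` of rank one less. -/
def dSummand {n : ℕ} (p q : ℕ) {r s : Setoid (Fin n)} (hrs : r ≤ s) (hrk : rk s = rk r + 1) :
    Summand Λ p (q + 1) s →ₗ[ℚ] Summand Λ (p + 2) q r :=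
  TensorProduct.map (gysin p hrk) (sigma q hrs)

variable (Λ) in
/-- `E_2^{p,q}(M(A_{n-1})/E) = ⨁_{rk W = q} H^p(W/E) ⊗ H^q(M(A_W))`. -/
abbrev E2 (n p q : ℕ) : Type := DirectSum (Layer n q) fun s => Summand Λ p q s.1

open scoped Classical in
variable (Λ) in
/-- The differential `d (x ⊗ ω) = ∑_{L < W, rk L = rk W - 1} G_L(x) ⊗ σ_L(ω)`. -/
def d (n p q : ℕ) : E2 Λ n p (q + 1) →ₗ[ℚ] E2 Λ n (p + 2) q :=
  DirectSum.toModule ℚ (Layer n (q + 1)) _ fun s =>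
    ∑ r : Layer n q, if h : r.1 ≤ s.1 then
      DirectSum.lof ℚ (Layer n q) (fun r => Summand Λ (p + 2) q r.1) r ∘ₗ
        dSummand p q h (s.2.trans (congrArg (· + 1) r.2.symm))
    else 0

variable (Λ) in
/-- The kernel of the differential that starts at `E_2^{p,q}`. -/
def cycles (n p : ℕ) : (q : ℕ) → Submodule ℚ (E2 Λ n p q)
  | 0 => ⊤
  | q + 1 => LinearMap.ker (d Λ n p q)

variable (Λ) in
/-- The image of the differential that ends at `E_2^{p,q}`. -/
def boundaries (n : ℕ) : (p q : ℕ) → Submodule ℚ (E2 Λ n p q)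
  | 0, _ => ⊥
  | 1, _ => ⊥
  | p + 2, q => LinearMap.range (d Λ n p q)

variable (Λ) in
/-- `E_3^{p,q}(M(A_{n-1})/E)`, the cohomology of the second page. -/
abbrev E3 (n p q : ℕ) : Type := cycles Λ n p q ⧸ (boundaries Λ n p q).submoduleOf (cycles Λ n p q)

/-! ### The action of `S_n × SL₂(ℚ)` -/

/-- The isomorphism of summands induced by an element of `S_n × SL₂(ℚ)`. -/
def summandMap {n : ℕ} (p q : ℕ) (g : Equiv.Perm (Fin n) × SL2) {s t : Setoid (Fin n)}
    (h : Carries g.1 s t) : Summand Λ p q s →ₗ[ℚ] Summand Λ p q t :=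
  TensorProduct.map
    (exteriorPower.map p (H1map (slRep Λ g.2) (blockMap g.1 fun i j => (h i j).1)))
    (osMap g.1 (fun i j => (h i j).2) q)

lemma summandMap_comp {n : ℕ} (p q : ℕ) (g k : Equiv.Perm (Fin n) × SL2)
    {s t u : Setoid (Fin n)} (h : Carries g.1 s t) (h' : Carries k.1 t u)
    (x : Summand Λ p q s) :
    summandMap p q k h' (summandMap p q g h x) = summandMap p q (k * g) (h.trans h') x := by
  suffices H : (summandMap (Λ := Λ) p q k h') ∘ₗ (summandMap p q g h) =
      summandMap p q (k * g) (h.trans h') from LinearMap.congr_fun H x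
  refine TensorProduct.ext' fun x y => ?_
  change (_ : ⋀[ℚ]^p (H1 Λ (Quotient u))) ⊗ₜ[ℚ] (_ : OS u q) = _ ⊗ₜ[ℚ] _
  congr 1
  · rw [← LinearMap.comp_apply, ← exteriorPower.map_comp, H1map_comp, Prod.snd_mul, map_mul]
    have : (blockMap k.1 fun i j => (h' i j).1) ∘ (blockMap g.1 fun i j => (h i j).1) =
        blockMap (k * g).1 fun i j => ((h.trans h') i j).1 := by
      funext b
      induction b using Quotient.inductionOn with
      | h k => rfl
    rw [this]; rfl
  · exact osMap_comp q h h' y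

lemma summandMap_one {n : ℕ} (p q : ℕ) {s : Setoid (Fin n)}
    (h : Carries (1 : Equiv.Perm (Fin n) × SL2).1 s s) (x : Summand Λ p q s) :
    summandMap p q 1 h x = x := by
  suffices H : summandMap (Λ := Λ) p q 1 h = LinearMap.id from LinearMap.congr_fun H x
  refine TensorProduct.ext' fun x y => ?_
  change (_ : ⋀[ℚ]^p (H1 Λ (Quotient s))) ⊗ₜ[ℚ] (_ : OS s q) = x ⊗ₜ[ℚ] y
  congr 1
  · have : (blockMap (1 : Equiv.Perm (Fin n) × SL2).1 fun i j => (h i j).1) =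
        (id : Quotient s → Quotient s) := by
      funext b
      induction b using Quotient.inductionOn with
      | h k => rfl
    rw [this, Prod.snd_one, map_one, Module.End.one_eq_id, H1map_id, exteriorPower.map_id,
      LinearMap.id_apply]
  · exact osMap_one q _ y

lemma dSummand_equivariant {n : ℕ} (p q : ℕ) (g : Equiv.Perm (Fin n) × SL2)
    {r s r' s' : Setoid (Fin n)} (hrs : r ≤ s) (hrs' : r' ≤ s')
    (hrk : rk s = rk r + 1) (hrk' : rk s' = rk r' + 1)
    (hr : Carries g.1 r r') (hs : Carries g.1 s s') (x : Summand Λ p (q + 1) s) :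
    dSummand p q hrs' hrk' (summandMap p (q + 1) g hs x) =
      summandMap (p + 2) q g hr (dSummand p q hrs hrk x) := by
  suffices H : (dSummand (Λ := Λ) p q hrs' hrk') ∘ₗ (summandMap p (q + 1) g hs) =
      (summandMap (p + 2) q g hr) ∘ₗ (dSummand p q hrs hrk) from LinearMap.congr_fun H x
  refine TensorProduct.ext' fun x y => ?_
  change (_ : ⋀[ℚ]^(p + 2) (H1 Λ (Quotient r'))) ⊗ₜ[ℚ] (_ : OS r' q) = _ ⊗ₜ[ℚ] _
  congr 1
  · exact gysin_equivariant p g.2 g.1 hrs hrs' _ _ hr hs x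
  · exact sigma_equivariant q g.1 hrs hrs' hr hs y

/-- The action of a permutation on the layers of rank `q`. -/
def actLayer {n : ℕ} (π : Equiv.Perm (Fin n)) {q : ℕ} (s : Layer n q) : Layer n q :=
  ⟨act π s.1, (rk_eq (carries_act π s.1)).trans s.2⟩

open scoped Classical in
lemma lof_summandMap {n : ℕ} {p q : ℕ} {g k : Equiv.Perm (Fin n) × SL2} (hgk : g = k)
    {s : Setoid (Fin n)} {t u : Layer n q} (h : Carries g.1 s t.1) (h' : Carries k.1 s u.1)
    (x : Summand Λ p q s) :
    DirectSum.lof ℚ (Layer n q) (fun s => Summand Λ p q s.1) t (summandMap p q g h x) =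
    DirectSum.lof ℚ (Layer n q) (fun s => Summand Λ p q s.1) u (summandMap p q k h' x) := by
  subst hgk
  have : t = u := Subtype.ext (h.eq.trans h'.eq.symm)
  subst this
  rfl

open scoped Classical in
/-- The action of an element of `S_n × SL₂(ℚ)` on `E_2^{p,q}`. -/
def E2map {n : ℕ} (p q : ℕ) (g : Equiv.Perm (Fin n) × SL2) : E2 Λ n p q →ₗ[ℚ] E2 Λ n p q :=
  DirectSum.toModule ℚ (Layer n q) _ fun s =>
    DirectSum.lof ℚ (Layer n q) (fun s => Summand Λ p q s.1) (actLayer g.1 s) ∘ₗ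
      summandMap p q g (carries_act g.1 s.1)

open scoped Classical in
lemma E2map_lof {n : ℕ} (p q : ℕ) (g : Equiv.Perm (Fin n) × SL2) (s : Layer n q)
    (x : Summand Λ p q s.1) :
    E2map p q g (DirectSum.lof ℚ (Layer n q) (fun s => Summand Λ p q s.1) s x) =
    DirectSum.lof ℚ (Layer n q) (fun s => Summand Λ p q s.1) (actLayer g.1 s)
      (summandMap p q g (carries_act g.1 s.1) x) := by
  rw [E2map, DirectSum.toModule_lof]; rfl

variable (Λ) in
/-- The representation of `S_n × SL₂(ℚ)` on `E_2^{p,q}(M(A_{n-1})/E)`. -/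
def E2Rep (n p q : ℕ) : Representation ℚ (Equiv.Perm (Fin n) × SL2) (E2 Λ n p q) where
  toFun g := E2map p q g
  map_one' := by
    classical
    apply DirectSum.linearMap_ext
    intro s
    apply LinearMap.ext
    intro x
    have hc : Carries (1 : Equiv.Perm (Fin n) × SL2).1 s.1 s.1 := fun _ _ => Iff.rfl
    change E2map p q 1 (DirectSum.lof ℚ (Layer n q) (fun s => Summand Λ p q s.1) s x) =
      DirectSum.lof ℚ (Layer n q) (fun s => Summand Λ p q s.1) s x
    rw [E2map_lof]
    refine (lof_summandMap (u := s) rfl _ hc x).trans ?_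
    rw [summandMap_one]
  map_mul' g k := by
    classical
    apply DirectSum.linearMap_ext
    intro s
    apply LinearMap.ext
    intro x
    change E2map p q (g * k) (DirectSum.lof ℚ (Layer n q) (fun s => Summand Λ p q s.1) s x) =
      E2map p q g (E2map p q k (DirectSum.lof ℚ (Layer n q) (fun s => Summand Λ p q s.1) s x))
    rw [E2map_lof, E2map_lof]
    refine Eq.trans ?_ (E2map_lof p q g (actLayer k.1 s) _).symm
    refine Eq.trans ?_ (congrArg _ (summandMap_comp p q k g (carries_act k.1 s.1)
      (carries_act g.1 (act k.1 s.1)) x).symm)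
    exact lof_summandMap rfl _ _ _

lemma act_le {n : ℕ} {π : Equiv.Perm (Fin n)} {r s : Setoid (Fin n)} :
    act π r ≤ act π s ↔ r ≤ s := by
  constructor
  · intro h i j hij
    exact (carries_act π s i j).2 (h ((carries_act π r i j).1 hij))
  · intro h i j hij
    exact h hij

open scoped Classical in
lemma d_lof {n : ℕ} (p q : ℕ) (s : Layer n (q + 1)) (x : Summand Λ p (q + 1) s.1) :
    d Λ n p q (DirectSum.lof ℚ (Layer n (q + 1)) (fun s => Summand Λ p (q + 1) s.1) s x) =
      ∑ r : Layer n q, if h : r.1 ≤ s.1 then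
        DirectSum.lof ℚ (Layer n q) (fun r => Summand Λ (p + 2) q r.1) r
          (dSummand p q h (s.2.trans (congrArg (· + 1) r.2.symm)) x)
      else 0 := by
  rw [d, DirectSum.toModule_lof, LinearMap.sum_apply]
  refine Finset.sum_congr rfl fun r _ => ?_
  split_ifs <;> rfl

lemma actLayer_bijective {n q : ℕ} (π : Equiv.Perm (Fin n)) :
    Function.Bijective (actLayer π : Layer n q → Layer n q) := by
  rw [← Finite.injective_iff_bijective]
  intro r s h
  have h' : act π r.1 = act π s.1 := congrArg Subtype.val h
  exact Subtype.ext (le_antisymm (act_le.1 h'.le) (act_le.1 h'.ge))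

/-- The differential is equivariant. -/
lemma d_equivariant (n p q : ℕ) (g : Equiv.Perm (Fin n) × SL2) (x : E2 Λ n p (q + 1)) :
    d Λ n p q (E2Rep Λ n p (q + 1) g x) = E2Rep Λ n (p + 2) q g (d Λ n p q x) := by
  classical
  suffices H : d Λ n p q ∘ₗ E2map p (q + 1) g = E2map (p + 2) q g ∘ₗ d Λ n p q from
    LinearMap.congr_fun H x
  apply DirectSum.linearMap_ext
  intro s
  apply LinearMap.ext
  intro y
  simp only [LinearMap.comp_apply]
  rw [E2map_lof, d_lof, map_sum]
  refine (d_lof p q (actLayer g.1 s) _).trans ?_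
  symm
  refine Fintype.sum_bijective (actLayer g.1) (actLayer_bijective g.1) _ _ fun r => ?_
  by_cases h : r.1 ≤ s.1
  · have h' : (actLayer g.1 r).1 ≤ (actLayer g.1 s).1 := act_le.2 h
    rw [dif_pos h, dif_pos h', E2map_lof]
    exact congrArg _ (dSummand_equivariant p q g h h' _ _ (carries_act _ _)
      (carries_act _ _) y).symm
  · have h' : ¬ (actLayer g.1 r).1 ≤ (actLayer g.1 s).1 := fun h' => h (act_le.1 h')
    rw [dif_neg h, dif_neg h', map_zero]

lemma cycles_invariant (n p q : ℕ) (g : Equiv.Perm (Fin n) × SL2) :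
    cycles Λ n p q ≤ (cycles Λ n p q).comap (E2Rep Λ n p q g) := by
  cases q with
  | zero => exact fun _ _ => trivial
  | succ q =>
    intro x hx
    have hx' : d Λ n p q x = 0 := hx
    change d Λ n p q _ = 0
    rw [d_equivariant, hx', map_zero]

lemma boundaries_invariant (n p q : ℕ) (g : Equiv.Perm (Fin n) × SL2) :
    boundaries Λ n p q ≤ (boundaries Λ n p q).comap (E2Rep Λ n p q g) := by
  match p with
  | 0 => rintro x (rfl : x = 0); exact (map_zero (E2Rep Λ n 0 q g)).symm ▸ zero_mem _
  | 1 => rintro x (rfl : x = 0); exact (map_zero (E2Rep Λ n 1 q g)).symm ▸ zero_mem _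
  | p + 2 =>
    rintro _ ⟨x, rfl⟩
    exact ⟨E2Rep Λ n p (q + 1) g x, d_equivariant n p q g x⟩

variable (Λ) in
/-- The representation of `S_n × SL₂(ℚ)` on `E_3^{p,q}(M(A_{n-1})/E)`. -/
def E3Rep (n p q : ℕ) : Representation ℚ (Equiv.Perm (Fin n) × SL2) (E3 Λ n p q) :=
  ((E2Rep Λ n p q).subrepresentation (cycles Λ n p q) (cycles_invariant n p q)).quotient
    ((boundaries Λ n p q).submoduleOf (cycles Λ n p q))
    fun g x hx => boundaries_invariant n p q g hx

/-! ### Representations of `S_n` and of `SL₂(ℚ)` -/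

/-- The external tensor product `V ⊠ W` of representations of two groups. -/
def box {G H V W : Type*} [Monoid G] [Monoid H] [AddCommGroup V] [Module ℚ V] [AddCommGroup W]
    [Module ℚ W] (ρ : Representation ℚ G V) (σ : Representation ℚ H W) :
    Representation ℚ (G × H) (V ⊗[ℚ] W) :=
  Representation.tprod (ρ.comp (MonoidHom.fst G H)) (σ.comp (MonoidHom.snd G H))

/-- The exterior power of a representation. -/
def extPowRep {G V : Type*} [Monoid G] [AddCommGroup V] [Module ℚ V]
    (ρ : Representation ℚ G V) (p : ℕ) : Representation ℚ G (⋀[ℚ]^p V) where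
  toFun g := exteriorPower.map p (ρ g)
  map_one' := by rw [map_one, Module.End.one_eq_id, exteriorPower.map_id]; rfl
  map_mul' g h := by rw [map_mul, Module.End.mul_eq_comp, exteriorPower.map_comp]; rfl

/-- The permutation action `(π f) i = f (π⁻¹ i)` of `S_n` on `ℚ^n`. -/
def permRep (n : ℕ) : Representation ℚ (Equiv.Perm (Fin n)) (Fin n → ℚ) where
  toFun π := LinearMap.funLeft ℚ ℚ π.symm
  map_one' := rfl
  map_mul' _ _ := rfl

/-- The space of vectors of `ℚ^n` with sum of the coordinates equal to zero. -/
def sumZero (n : ℕ) : Submodule ℚ (Fin n → ℚ) :=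
  LinearMap.ker (∑ i : Fin n, LinearMap.proj i : (Fin n → ℚ) →ₗ[ℚ] ℚ)

/-- The standard representation `V(1)` of `S_n`, of dimension `n - 1`. -/
def stdRep (n : ℕ) : Representation ℚ (Equiv.Perm (Fin n)) (sumZero n) :=
  (permRep n).subrepresentation (sumZero n) fun π f hf => by
    simp only [sumZero, LinearMap.mem_ker, LinearMap.sum_apply, LinearMap.proj_apply,
      Submodule.mem_comap] at hf ⊢
    rw [← hf]
    exact Equiv.sum_comp π.symm f

/-- The algebra automorphism of `ℚ[x, y]` that extends the standard action of `A ∈ SL₂(ℚ)` on the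
span of the variables, `x ↦ A₀₀ x + A₁₀ y` and `y ↦ A₀₁ x + A₁₁ y`. -/
def polyAct (A : SL2) : MvPolynomial (Fin 2) ℚ →ₐ[ℚ] MvPolynomial (Fin 2) ℚ :=
  MvPolynomial.aeval fun j => ∑ i : Fin 2, MvPolynomial.C (A.1 i j) * MvPolynomial.X i

lemma polyAct_mem (A : SL2) (p : ℕ) (f : MvPolynomial (Fin 2) ℚ)
    (hf : f ∈ MvPolynomial.homogeneousSubmodule (Fin 2) ℚ p) :
    polyAct A f ∈ MvPolynomial.homogeneousSubmodule (Fin 2) ℚ p := by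
  rw [MvPolynomial.mem_homogeneousSubmodule] at hf ⊢
  have := hf.aeval (fun j => ∑ i : Fin 2, MvPolynomial.C (A.1 i j) * MvPolynomial.X i) (n := 1)
    fun j => MvPolynomial.IsHomogeneous.sum _ _ _ fun i _ => MvPolynomial.isHomogeneous_C_mul_X _ _
  rwa [one_mul] at this

/-- The irreducible representation `V_p` of `SL₂(ℚ)` of dimension `p + 1`: the `p`-th symmetric
power of the standard representation, that is, the binary forms of degree `p`. -/
def VRep (p : ℕ) :
    Representation ℚ SL2 (MvPolynomial.homogeneousSubmodule (Fin 2) ℚ p) where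
  toFun A := (polyAct A).toLinearMap.restrict (polyAct_mem A p)
  map_one' := by
    ext1 f
    apply Subtype.ext
    change polyAct 1 f.1 = f.1
    have : polyAct 1 = AlgHom.id ℚ _ := by
      apply MvPolynomial.algHom_ext
      intro j
      fin_cases j <;> simp [polyAct]
    rw [this]; rfl
  map_mul' A B := by
    ext1 f
    apply Subtype.ext
    change polyAct (A * B) f.1 = polyAct A (polyAct B f.1)
    have : polyAct (A * B) = (polyAct A).comp (polyAct B) := by
      apply MvPolynomial.algHom_ext
      intro j
      simp only [polyAct, MvPolynomial.aeval_X, AlgHom.comp_apply, Fin.sum_univ_two, map_add,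
        map_mul, Matrix.SpecialLinearGroup.coe_mul, Matrix.mul_apply, MvPolynomial.algHom_C,
        MvPolynomial.algebraMap_eq]
      ring
    rw [this]; rfl

/-! ### Specht modules -/

/-- The permutation module on tabloids: a tabloid with entries in `Fin n` is recorded by the
function that sends an entry to the index of its row. -/
def tabloidRep (n : ℕ) :
    Representation ℚ (Equiv.Perm (Fin n)) ((Fin n → ℕ) →₀ ℚ) where
  toFun π := Finsupp.lmapDomain ℚ ℚ fun f => f ∘ π.symm
  map_one' := by
    apply Finsupp.lhom_ext
    intro f c
    simp only [Finsupp.lmapDomain_apply, Finsupp.mapDomain_single]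
    rfl
  map_mul' π ρ := by
    ext1 f
    ext1
    simp only [LinearMap.comp_apply, Finsupp.lsingle_apply, Module.End.mul_apply,
      Finsupp.lmapDomain_apply, Finsupp.mapDomain_single]
    rfl

open scoped Classical in
/-- The polytabloid `∑ sgn(g) {g T}` of a tableau `T`, where `g` runs over the permutations of the
entries that preserve the columns of `T`. The tableau is given as the function that sends an entry
to its cell `(row, column)`. -/
def polytabloid {n : ℕ} (μ : YoungDiagram) (T : Fin n ≃ μ.cells) : (Fin n → ℕ) →₀ ℚ :=
  ∑ g : Equiv.Perm (Fin n), if (∀ i, (T (g i)).1.2 = (T i).1.2) then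
    Finsupp.single (fun i => (T (g.symm i)).1.1) ((Equiv.Perm.sign g : ℤ) : ℚ) else 0

/-- The space of the Specht module of shape `μ`. -/
def spechtSpace (n : ℕ) (μ : YoungDiagram) : Submodule ℚ ((Fin n → ℕ) →₀ ℚ) :=
  Submodule.span ℚ (Set.range fun T : Fin n ≃ μ.cells => polytabloid μ T)

lemma tabloidRep_polytabloid {n : ℕ} (μ : YoungDiagram) (T : Fin n ≃ μ.cells)
    (π : Equiv.Perm (Fin n)) :
    tabloidRep n π (polytabloid μ T) = polytabloid μ (π.symm.trans T) := by
  classical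
  rw [polytabloid, map_sum, polytabloid]
  refine Fintype.sum_equiv (MulAut.conj π).toEquiv _ _ fun g => ?_
  have hiff : (∀ i, (T (g i)).1.2 = (T i).1.2) ↔
      ∀ i, ((π.symm.trans T) ((MulAut.conj π).toEquiv g i)).1.2 = ((π.symm.trans T) i).1.2 := by
    constructor
    · intro h i
      have := h (π.symm i)
      simpa using this
    · intro h i
      have := h (π i)
      simpa using this
  by_cases h : ∀ i, (T (g i)).1.2 = (T i).1.2
  · rw [if_pos h, if_pos (hiff.1 h)]
    change Finsupp.mapDomain _ (Finsupp.single _ _) = _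
    rw [Finsupp.mapDomain_single]
    congr 1
    · funext i
      have : ((MulAut.conj π).toEquiv g).symm i = π (g.symm (π.symm i)) := by
        rw [Equiv.symm_apply_eq]; simp
      rw [this]; simp
    · have : Equiv.Perm.sign ((MulAut.conj π).toEquiv g) = Equiv.Perm.sign g := by
        change Equiv.Perm.sign (π * g * π⁻¹) = Equiv.Perm.sign g
        rw [map_mul, map_mul, map_inv, mul_comm (Equiv.Perm.sign π), mul_assoc,
          mul_inv_cancel, mul_one]
      rw [this]
  · rw [if_neg h, if_neg fun h' => h (hiff.2 h'), map_zero]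

/-- The Specht module of shape `μ`, the irreducible representation of `S_n` attached to a
partition `μ` of `n`. -/
def spechtRep (n : ℕ) (μ : YoungDiagram) :
    Representation ℚ (Equiv.Perm (Fin n)) (spechtSpace n μ) :=
  (tabloidRep n).subrepresentation (spechtSpace n μ) fun π => by
    rw [spechtSpace, Submodule.span_le]
    rintro _ ⟨T, rfl⟩
    exact Submodule.subset_span ⟨π.symm.trans T, (tabloidRep_polytabloid μ T π).symm⟩

/-- The hook with a first row of length `a` and `b` further rows of length one (for `1 ≤ a`), the
diagram of the partition `(a, 1, …, 1)` of `a + b`. -/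
def hook (a b : ℕ) : YoungDiagram where
  cells := (Finset.range (b + 1) ×ˢ Finset.range a).filter fun c => c.1 = 0 ∨ c.2 = 0
  isLowerSet := by
    rintro ⟨i, j⟩ ⟨k, l⟩ ⟨h1, h2⟩ h
    simp only [Finset.coe_filter, Finset.mem_product, Finset.mem_range, Set.mem_ofPred_eq] at h ⊢
    simp only at h1 h2
    omega

end

end EllipticBraid

/-!
# The bottom row of the third page for the braid elliptic arrangement

Write `V = V(1)` for the sum-zero subspace of `ℚ^n`. The cohomology of `E^n / E` is the exterior
algebra of `H¹(E^n / E) = V ⊗ ℚ²`, and the class of the divisor `P_i = P_j` is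
`(u ⊗ x)(u ⊗ y)` with `u = e_i - e_j`. A layer of codimension one is one of these divisors, with a
local cohomology generated by `ω_{ij}` and `∂ ω_{ij} = 1`, so by the projection formula the image of
the differential in `E_2^{p,0}` is the degree `p` part of the ideal generated by the divisor classes.

The quadratic map `u ↦ (u ⊗ x)(u ⊗ y)` is determined by its values on the roots
(`segreIdeal_univ_le_roots`), so this ideal contains `(u ⊗ x)(u ⊗ y)` for every `u ∈ V`. The quotient
of `⋀(V ⊗ ℚ²)` by these relations is the Segre product `⨁ ⋀^p V ⊗ Sym^p ℚ²`, inside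
`⋀V ⊗ ℚ[x, y]`. Indeed, the relations let every element of degree `p` be written as a sum of sorted
words `(u₁ ⊗ x) ⋯ (u_k ⊗ x)(u_{k+1} ⊗ y) ⋯ (u_p ⊗ y)`, which are alternating in `u₁, …, u_p` modulo
the relations, whereas the images `u₁ ∧ ⋯ ∧ u_p ⊗ x^k y^(p-k)` for distinct `k` are independent
(`mem_segreIdeal_of_segre_eq_zero`, `map_segre_exteriorPower`). This gives
`E_3^{p,0} ≅ ⋀^p V ⊠ V_p` (`e3Equiv`) and, by counting monomials, the dimension.

For the hook `(n - p, 1^p)`, a tabloid is an ordered choice of `p` distinct entries for the rows below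
the first, and the minors `det (v_i(d_j))` embed `⋀^p V` in the tabloid module. The products
`(e_{c_1} - e_{c_0}) ∧ ⋯ ∧ (e_{c_p} - e_{c_0})` span `⋀^p V` and are sent to the polytabloids, so the
image is the Specht module (`range_tabloidExpansion`).
-/

open scoped TensorProduct

namespace EllipticBraid

noncomputable section

/-! ### The Segre product of an exterior and a polynomial algebra -/

section Segre

variable {K V : Type*} [Field K] [AddCommGroup V] [Module K V]

variable (K V) in
/-- The algebra map `⋀(V ⊗ K²) → ⋀V ⊗ K[x, y]` that extends `u ⊗ h ↦ u ⊗ h`. The space `V ⊗ K²` is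
encoded as `V × V`, with `(a, b)` standing for `a ⊗ x + b ⊗ y`. -/
def segre : ExteriorAlgebra K (V × V) →ₐ[K]
    ExteriorAlgebra K V ⊗[K] MvPolynomial (Fin 2) K :=
  ExteriorAlgebra.lift K
    ⟨((TensorProduct.mk K _ _).flip (MvPolynomial.X 0) ∘ₗ ExteriorAlgebra.ι K).coprod
      ((TensorProduct.mk K _ _).flip (MvPolynomial.X 1) ∘ₗ ExteriorAlgebra.ι K), by
    rintro ⟨a, b⟩
    have hab : ExteriorAlgebra.ι K b * ExteriorAlgebra.ι K a =
        - (ExteriorAlgebra.ι K a * ExteriorAlgebra.ι K b) :=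
      eq_neg_of_add_eq_zero_left (ExteriorAlgebra.ι_add_mul_swap b a)
    simp only [LinearMap.coprod_apply, LinearMap.comp_apply, LinearMap.flip_apply,
      TensorProduct.mk_apply, mul_add, add_mul, Algebra.TensorProduct.tmul_mul_tmul,
      ExteriorAlgebra.ι_sq_zero, TensorProduct.zero_tmul, zero_add, add_zero, hab,
      TensorProduct.neg_tmul, mul_comm (MvPolynomial.X (R := K) (1 : Fin 2))]
    exact neg_add_cancel _⟩

lemma segre_ι (a b : V) : segre K V (ExteriorAlgebra.ι K (a, b)) =
    ExteriorAlgebra.ι K a ⊗ₜ MvPolynomial.X 0 + ExteriorAlgebra.ι K b ⊗ₜ MvPolynomial.X 1 := by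
  rw [segre, ExteriorAlgebra.lift_ι_apply]; rfl

variable (K) in
/-- The quadratic element `(u ⊗ x)(u ⊗ y)`. -/
def segreRelation (u : V) : ExteriorAlgebra K (V × V) :=
  ExteriorAlgebra.ι K (u, 0) * ExteriorAlgebra.ι K (0, u)

variable (K) in
/-- The left ideal generated by the elements `(u ⊗ x)(u ⊗ y)` for `u ∈ D`. It is two-sided, since the
generators are central: see `segreIdeal_mul_mem_right`. -/
def segreIdeal (D : Set V) : Ideal (ExteriorAlgebra K (V × V)) :=
  Ideal.span (segreRelation K '' D)

lemma segre_segreRelation (u : V) : segre K V (segreRelation K u) = 0 := by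
  simp [segreRelation, segre_ι, Algebra.TensorProduct.tmul_mul_tmul]

lemma segre_eq_zero_of_mem {D : Set V} {x : ExteriorAlgebra K (V × V)}
    (hx : x ∈ segreIdeal K D) : segre K V x = 0 := by
  have : segreIdeal K D ≤ RingHom.ker (segre K V) := by
    rw [segreIdeal, Ideal.span_le]
    rintro _ ⟨u, -, rfl⟩
    exact segre_segreRelation u
  exact this hx

lemma ι_mul_swap {M : Type*} [AddCommGroup M] [Module K M] (v w : M) :
    ExteriorAlgebra.ι K v * ExteriorAlgebra.ι K w =
      - (ExteriorAlgebra.ι K w * ExteriorAlgebra.ι K v) :=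
  eq_neg_of_add_eq_zero_left (ExteriorAlgebra.ι_add_mul_swap v w)

lemma ι_mul_comm_of_mem {M : Type*} [AddCommGroup M] [Module K M] (v : M) {p : ℕ}
    {x : ExteriorAlgebra K M} (hx : x ∈ ⋀[K]^p M) :
    ExteriorAlgebra.ι K v * x = (-1 : K) ^ p • (x * ExteriorAlgebra.ι K v) := by
  induction p generalizing x with
  | zero =>
    rw [ExteriorAlgebra.exteriorPower, pow_zero] at hx
    obtain ⟨c, rfl⟩ := Submodule.mem_one.1 hx
    rw [pow_zero, one_smul, Algebra.commutes]
  | succ p ih =>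
    rw [ExteriorAlgebra.exteriorPower, pow_succ'] at hx
    induction hx using Submodule.mul_induction_on' with
    | mem_mul_mem m hm y hy =>
      obtain ⟨w, rfl⟩ := hm
      rw [← mul_assoc, ι_mul_swap v w, neg_mul, mul_assoc, ih hy, mul_smul_comm, mul_assoc,
        pow_succ]
      simp
    | add x _ y _ h1 h2 => rw [mul_add, add_mul, smul_add, h1, h2]

lemma mul_segreRelation_comm (x : ExteriorAlgebra K (V × V)) (u : V) :
    x * segreRelation K u = segreRelation K u * x := by
  induction x using ExteriorAlgebra.induction with
  | algebraMap c => exact Algebra.commutes c _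
  | ι w =>
    rw [segreRelation, ← mul_assoc, ι_mul_swap w, neg_mul, mul_assoc, ι_mul_swap w, mul_neg,
      neg_neg, mul_assoc]
  | add a b ha hb => rw [add_mul, mul_add, ha, hb]
  | mul a b ha hb => rw [mul_assoc, hb, ← mul_assoc, ha, mul_assoc]

lemma segreIdeal_mul_mem_right {D : Set V} {x : ExteriorAlgebra K (V × V)}
    (hx : x ∈ segreIdeal K D) (y : ExteriorAlgebra K (V × V)) : x * y ∈ segreIdeal K D := by
  induction hx using Submodule.span_induction with
  | mem x hx =>
    obtain ⟨u, hu, rfl⟩ := hx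
    rw [← mul_segreRelation_comm]
    exact Ideal.mul_mem_left _ _ (Ideal.subset_span ⟨u, hu, rfl⟩)
  | zero => simp
  | add x x' _ _ h h' => rw [add_mul]; exact add_mem h h'
  | smul a x _ h => rw [smul_eq_mul, mul_assoc]; exact Ideal.mul_mem_left _ _ h

/-- The factors `u ⊗ x` and `u ⊗ y` need not be adjacent for a product to lie in the ideal, because
`u ⊗ x` anticommutes with every generator in between. -/
lemma ι_mul_mul_ι_mem (u : V) (y : ExteriorAlgebra K (V × V)) :
    ExteriorAlgebra.ι K (u, 0) * y * ExteriorAlgebra.ι K (0, u) ∈ segreIdeal K Set.univ := by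
  have hu : ExteriorAlgebra.ι K (u, 0) * ExteriorAlgebra.ι K (0, u) ∈
      segreIdeal K (Set.univ : Set V) := Ideal.subset_span ⟨u, trivial, rfl⟩
  suffices H : ∀ z, ExteriorAlgebra.ι K (u, 0) * z * ExteriorAlgebra.ι K (0, u) ∈
      segreIdeal K Set.univ → ExteriorAlgebra.ι K (u, 0) * (y * z) * ExteriorAlgebra.ι K (0, u) ∈
      segreIdeal K Set.univ by
    have := H 1 (by rwa [mul_one])
    rwa [mul_one] at this
  induction y using ExteriorAlgebra.induction with
  | algebraMap c =>
    intro z hz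
    rw [← Algebra.smul_def, mul_smul_comm, smul_mul_assoc, Algebra.smul_def]
    exact Ideal.mul_mem_left _ _ hz
  | ι w =>
    intro z hz
    rw [← mul_assoc, ι_mul_swap (u, 0) w, neg_mul, neg_mul, mul_assoc, mul_assoc]
    rw [mul_assoc] at hz
    exact neg_mem (Ideal.mul_mem_left _ _ hz)
  | add a b ha hb =>
    intro z hz
    rw [add_mul, mul_add, add_mul]
    exact add_mem (ha z hz) (hb z hz)
  | mul a b ha hb =>
    intro z hz
    rw [mul_assoc a b z]
    exact ha _ (hb z hz)

lemma ofFn_prod_eq_mul_mul_mul_mul {A : Type*} [Monoid A] {p : ℕ} (f : Fin p → A) {i j : Fin p}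
    (hij : i < j) : ∃ a b c, (List.ofFn f).prod = a * (f i * b * f j) * c := by
  have key : ∀ (l : List A) (k : ℕ) (hk : k < l.length),
      l.prod = (l.take k).prod * (l[k] * (l.drop (k + 1)).prod) := by
    intro l k hk
    rw [← List.prod_cons, ← List.drop_eq_getElem_cons hk, ← List.prod_append,
      List.take_append_drop]
  have hi : (i : ℕ) < (List.ofFn f).length := by simp
  have hj : (j : ℕ) - (i + 1) < ((List.ofFn f).drop (i + 1)).length := by
    simp only [List.length_drop, List.length_ofFn]
    have := j.2
    have : (i : ℕ) < j := hij
    omega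
  refine ⟨((List.ofFn f).take i).prod, (((List.ofFn f).drop (i + 1)).take (j - (i + 1))).prod,
    (((List.ofFn f).drop (i + 1)).drop (j - (i + 1) + 1)).prod, ?_⟩
  have e : (i : ℕ) + 1 + (j - (i + 1)) = j := by
    have : (i : ℕ) < j := hij
    omega
  rw [key _ i hi, key _ _ hj]
  simp only [List.getElem_drop, List.getElem_ofFn, e, Fin.eta, mul_assoc]

variable (K V) in
/-- The map `u ↦ u ⊗ x` in the positions `i < k`, and `u ↦ u ⊗ y` in the others. -/
def letterIncl (k : ℕ) {p : ℕ} (i : Fin p) : V →ₗ[K] V × V :=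
  if (i : ℕ) < k then LinearMap.inl K V V else LinearMap.inr K V V

variable (K V) in
/-- The product `(u₁ ⊗ x) ⋯ (u_k ⊗ x) (u_{k+1} ⊗ y) ⋯ (u_p ⊗ y)`. -/
def sortedWord (p k : ℕ) : MultilinearMap K (fun _ : Fin p => V) (ExteriorAlgebra K (V × V)) :=
  (ExteriorAlgebra.ιMulti K p).toMultilinearMap.compLinearMap (letterIncl K V k)

lemma sortedWord_apply (p k : ℕ) (u : Fin p → V) :
    sortedWord K V p k u = ExteriorAlgebra.ιMulti K p fun i => letterIncl K V k i (u i) := rfl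

/-- Modulo the ideal, sorted words are alternating in all their entries, also across the boundary
between the two kinds of letters. -/
lemma sortedWord_mem_of_eq (p k : ℕ) (u : Fin p → V) (i j : Fin p) (h : u i = u j) (hij : i ≠ j) :
    sortedWord K V p k u ∈ segreIdeal K Set.univ := by
  wlog hlt : i < j generalizing i j
  · exact this j i h.symm hij.symm (lt_of_le_of_ne (not_lt.1 hlt) hij.symm)
  have hlt' : (i : ℕ) < j := hlt
  rw [sortedWord_apply]
  by_cases hk : (i : ℕ) < k ∧ ¬ (j : ℕ) < k
  · obtain ⟨a, b, c, e⟩ := ofFn_prod_eq_mul_mul_mul_mul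
      (fun i => ExteriorAlgebra.ι K (letterIncl K V k i (u i))) hlt
    rw [ExteriorAlgebra.ιMulti_apply, e]
    simp only [letterIncl, if_pos hk.1, if_neg hk.2, LinearMap.inl_apply, LinearMap.inr_apply, h]
    exact segreIdeal_mul_mem_right (Ideal.mul_mem_left _ _ (ι_mul_mul_ι_mem _ _)) _
  · rw [AlternatingMap.map_eq_zero_of_eq _ _ _ hij]
    · exact zero_mem _
    · have : (i : ℕ) < k ↔ (j : ℕ) < k := by omega
      simp only [letterIncl, this, h]

variable (K V) in
/-- The map from `⋀^p V` induced by the sorted words with `k` letters `x`. -/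
def sortedWordMap (p k : ℕ) : ⋀[K]^p V →ₗ[K]
    (ExteriorAlgebra K (V × V) ⧸ (segreIdeal K (Set.univ : Set V)).restrictScalars K) :=
  exteriorPower.alternatingMapLinearEquiv
    { (Submodule.mkQ _).compMultilinearMap (sortedWord K V p k) with
      map_eq_zero_of_eq' := fun u i j h hij =>
        (Submodule.Quotient.mk_eq_zero _).2 (sortedWord_mem_of_eq p k u i j h hij) }

lemma sortedWordMap_ιMulti (p k : ℕ) (u : Fin p → V) :
    sortedWordMap K V p k (exteriorPower.ιMulti K p u) =
      Submodule.Quotient.mk (sortedWord K V p k u) := by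
  rw [sortedWordMap, exteriorPower.alternatingMapLinearEquiv_apply_ιMulti]; rfl

lemma ι_mul_sortedWord (p k : ℕ) (a : V) (u : Fin p → V) :
    ExteriorAlgebra.ι K (a, 0) * sortedWord K V p k u =
      sortedWord K V (p + 1) (k + 1) (Fin.cons a u) := by
  rw [sortedWord_apply, sortedWord_apply, ExteriorAlgebra.ιMulti_apply,
    ExteriorAlgebra.ιMulti_apply, List.ofFn_succ, List.prod_cons]
  simp [letterIncl]

lemma sortedWord_mul_ι {p k : ℕ} (hk : k ≤ p) (b : V) (u : Fin p → V) :
    sortedWord K V p k u * ExteriorAlgebra.ι K (0, b) = sortedWord K V (p + 1) k (Fin.snoc u b) := by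
  rw [sortedWord_apply, sortedWord_apply, ExteriorAlgebra.ιMulti_apply,
    ExteriorAlgebra.ιMulti_apply, List.ofFn_succ', List.concat_eq_append, List.prod_append, List.prod_singleton]
  simp [letterIncl, not_lt.2 hk]

/-- Sorted words span: a new letter `x` is added on the left, and a new letter `y` is moved, up to
sign, to the right end. -/
lemma exteriorPower_le_span_sortedWord (p : ℕ) : ⋀[K]^p (V × V) ≤
    Submodule.span K {x | ∃ k ≤ p, ∃ u, x = sortedWord K V p k u} := by
  induction p with
  | zero =>
    rw [ExteriorAlgebra.exteriorPower, pow_zero, Submodule.one_eq_span, Submodule.span_le,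
      Set.singleton_subset_iff]
    exact Submodule.subset_span ⟨0, le_rfl, 0, by simp [sortedWord_apply]⟩
  | succ p ih =>
    rw [ExteriorAlgebra.exteriorPower, pow_succ', Submodule.mul_le]
    rintro _ ⟨⟨a, b⟩, rfl⟩ z hz
    have e : ((a, b) : V × V) = (a, 0) + (0, b) := by simp
    rw [e, map_add, add_mul, ι_mul_comm_of_mem (0, b) hz]
    have hz' := ih hz
    refine add_mem ?_ (Submodule.smul_mem _ _ ?_)
    · clear hz
      induction hz' using Submodule.span_induction with
      | mem x hx =>
        obtain ⟨k, hk, u, rfl⟩ := hx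
        exact Submodule.subset_span ⟨k + 1, by omega, _, ι_mul_sortedWord p k a u⟩
      | zero => simp
      | add x y _ _ h1 h2 => rw [mul_add]; exact add_mem h1 h2
      | smul c x _ h => rw [mul_smul_comm]; exact Submodule.smul_mem _ _ h
    · clear hz
      induction hz' using Submodule.span_induction with
      | mem x hx =>
        obtain ⟨k, hk, u, rfl⟩ := hx
        exact Submodule.subset_span ⟨k, by omega, _, sortedWord_mul_ι hk b u⟩
      | zero => simp
      | add x y _ _ h1 h2 => rw [add_mul]; exact add_mem h1 h2
      | smul c x _ h => rw [smul_mul_assoc]; exact Submodule.smul_mem _ _ h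

lemma ofFn_tmul_prod {A B : Type*} [Ring A] [Algebra K A] [CommRing B] [Algebra K B] {p : ℕ}
    (a : Fin p → A) (b : Fin p → B) :
    (List.ofFn fun i => a i ⊗ₜ[K] b i).prod = (List.ofFn a).prod ⊗ₜ[K] ∏ i, b i := by
  induction p with
  | zero => simp [Algebra.TensorProduct.one_def]
  | succ p ih =>
    rw [List.ofFn_succ, List.prod_cons, ih, Algebra.TensorProduct.tmul_mul_tmul, List.ofFn_succ,
      List.prod_cons, Fin.prod_univ_succ]

/-- The exponent of the monomial `x^k y^(p-k)`. -/
def binaryMonomial (p : ℕ) (k : Fin (p + 1)) : Fin 2 →₀ ℕ :=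
  Finsupp.single 0 (k : ℕ) + Finsupp.single 1 (p - k)

lemma segre_sortedWord {p : ℕ} (k : Fin (p + 1)) (u : Fin p → V) :
    segre K V (sortedWord K V p k u) = ExteriorAlgebra.ιMulti K p u ⊗ₜ
      MvPolynomial.monomial (binaryMonomial p k) 1 := by
  rw [sortedWord_apply, ExteriorAlgebra.ιMulti_apply, map_list_prod, List.map_ofFn]
  have : (segre K V ∘ fun i => ExteriorAlgebra.ι K (letterIncl K V k i (u i))) = fun i =>
      ExteriorAlgebra.ι K (u i) ⊗ₜ
        (if (i : ℕ) < k then MvPolynomial.X 0 else MvPolynomial.X 1) := by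
    funext i
    simp only [Function.comp_apply, letterIncl]
    split_ifs <;> simp [segre_ι]
  rw [this, ofFn_tmul_prod, ExteriorAlgebra.ιMulti_apply]
  congr 1
  have hk : (k : ℕ) ≤ p := Nat.lt_succ_iff.1 k.2
  have h1 : (Finset.univ.filter fun i : Fin p => (i : ℕ) < k).card = k := by
    rw [Fin.card_filter_val_lt, min_eq_right hk]
  have h2 : (Finset.univ.filter fun i : Fin p => ¬ (i : ℕ) < k).card = p - k := by
    have := Finset.card_filter_add_card_filter_not (s := (Finset.univ : Finset (Fin p)))
      (fun i : Fin p => (i : ℕ) < k)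
    rw [Finset.card_univ, Fintype.card_fin] at this
    omega
  rw [Finset.prod_ite, Finset.prod_const, Finset.prod_const, h1, h2, MvPolynomial.X_pow_eq_monomial,
    MvPolynomial.X_pow_eq_monomial, MvPolynomial.monomial_mul, one_mul, binaryMonomial]

variable (K V) in
/-- The inclusion of `⋀^p V ⊗ Sym^p K²` in `⋀V ⊗ K[x, y]`. -/
def boxIncl (p : ℕ) : ⋀[K]^p V ⊗[K] MvPolynomial.homogeneousSubmodule (Fin 2) K p →ₗ[K]
    ExteriorAlgebra K V ⊗[K] MvPolynomial (Fin 2) K :=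
  TensorProduct.map (⋀[K]^p V).subtype (MvPolynomial.homogeneousSubmodule (Fin 2) K p).subtype

lemma boxIncl_injective (p : ℕ) : Function.Injective (boxIncl K V p) :=
  TensorProduct.map_injective_of_flat_flat _ _ (Submodule.subtype_injective _)
    (Submodule.subtype_injective _)

lemma binaryMonomial_injective (p : ℕ) : Function.Injective (binaryMonomial p) := by
  intro k l h
  have := DFunLike.congr_fun h 0
  simp only [binaryMonomial, Finsupp.add_apply, Finsupp.single_eq_same] at this
  simpa [Fin.ext_iff] using this

lemma homogeneousSubmodule_eq_span_binaryMonomial (p : ℕ) :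
    MvPolynomial.homogeneousSubmodule (Fin 2) K p =
      Submodule.span K (Set.range fun k => MvPolynomial.monomial (binaryMonomial p k) (1 : K)) := by
  apply le_antisymm
  · intro f hf
    rw [MvPolynomial.as_sum f]
    refine Submodule.sum_mem _ fun m hm => ?_
    have hdeg : m 0 + m 1 = p := by
      rw [← hf (MvPolynomial.mem_support_iff.1 hm), Pi.one_def, ← Finsupp.degree_eq_weight_one,
        Finsupp.degree_eq_sum, Fin.sum_univ_two]
    have hm' : m = binaryMonomial p ⟨m 0, by omega⟩ := by
      ext i
      fin_cases i
      · simp [binaryMonomial]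
      · simp [binaryMonomial]; omega
    rw [← mul_one (MvPolynomial.coeff m f), ← smul_eq_mul, ← MvPolynomial.smul_monomial]
    exact Submodule.smul_mem _ _ (Submodule.subset_span
      ⟨_, congrArg (MvPolynomial.monomial · (1 : K)) hm'.symm⟩)
  · rw [Submodule.span_le]
    rintro _ ⟨k, rfl⟩
    apply MvPolynomial.isHomogeneous_monomial
    have hk : (k : ℕ) ≤ p := Nat.lt_succ_iff.1 k.2
    simp only [binaryMonomial, Finsupp.degree_eq_sum, Fin.sum_univ_two, Finsupp.add_apply,
      Finsupp.single_apply]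
    simp
    omega

variable (K V) in
/-- The map `(ω_k) ↦ ∑ ω_k ⊗ x^k y^(p-k)`, another parametrization of the subspace
`⋀^p V ⊗ Sym^p K²`. -/
def monomialSum (p : ℕ) : (Fin (p + 1) → ⋀[K]^p V) →ₗ[K]
    ExteriorAlgebra K V ⊗[K] MvPolynomial (Fin 2) K :=
  ∑ k, (TensorProduct.mk K _ _).flip (MvPolynomial.monomial (binaryMonomial p k) 1) ∘ₗ
    (⋀[K]^p V).subtype ∘ₗ LinearMap.proj k

lemma monomialSum_apply (p : ℕ) (ω : Fin (p + 1) → ⋀[K]^p V) :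
    monomialSum K V p ω = ∑ k, (ω k : ExteriorAlgebra K V) ⊗ₜ
      MvPolynomial.monomial (binaryMonomial p k) 1 := by
  simp [monomialSum]

lemma monomialSum_injective (p : ℕ) : Function.Injective (monomialSum K V p) := by
  rw [injective_iff_map_eq_zero]
  intro ω h
  funext k
  -- The coefficient of `x^k y^(p-k)` recovers `ω k`.
  have := congrArg ((TensorProduct.rid K _).toLinearMap ∘ₗ LinearMap.lTensor (ExteriorAlgebra K V)
    (MvPolynomial.lcoeff K (binaryMonomial p k))) h
  rw [monomialSum_apply] at this
  simpa [MvPolynomial.coeff_monomial, (binaryMonomial_injective p).eq_iff] using this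

lemma range_monomialSum (p : ℕ) :
    LinearMap.range (monomialSum K V p) = LinearMap.range (boxIncl K V p) := by
  apply le_antisymm
  · rintro _ ⟨ω, rfl⟩
    rw [monomialSum_apply]
    refine Submodule.sum_mem _ fun k _ => ⟨ω k ⊗ₜ ⟨MvPolynomial.monomial (binaryMonomial p k) 1, ?_⟩,
      rfl⟩
    rw [homogeneousSubmodule_eq_span_binaryMonomial]
    exact Submodule.subset_span ⟨k, rfl⟩
  · rintro _ ⟨x, rfl⟩
    induction x using TensorProduct.induction_on with
    | zero => simp
    | add x y hx hy => rw [map_add]; exact add_mem hx hy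
    | tmul ω f =>
      obtain ⟨f, hf⟩ := f
      change (ω : ExteriorAlgebra K V) ⊗ₜ f ∈ _
      rw [homogeneousSubmodule_eq_span_binaryMonomial] at hf
      induction hf using Submodule.span_induction with
      | mem f hf =>
        obtain ⟨k, rfl⟩ := hf
        refine ⟨Pi.single k ω, ?_⟩
        rw [monomialSum_apply, Finset.sum_eq_single k]
        · simp
        · intro l _ hl; simp [Pi.single_eq_of_ne hl]
        · simp
      | zero => simp
      | add f g _ _ hf hg => rw [TensorProduct.tmul_add]; exact add_mem hf hg
      | smul c f _ hf => rw [TensorProduct.tmul_smul]; exact Submodule.smul_mem _ _ hf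

lemma finrank_box [Module.Finite K V] (p : ℕ) :
    Module.finrank K (⋀[K]^p V ⊗[K] MvPolynomial.homogeneousSubmodule (Fin 2) K p) =
      (Module.finrank K V).choose p * (p + 1) := by
  rw [← LinearMap.finrank_range_of_inj (boxIncl_injective p), ← range_monomialSum,
    LinearMap.finrank_range_of_inj (monomialSum_injective p), Module.finrank_pi_fintype]
  simp [exteriorPower.finrank_eq, mul_comm]

instance finite_box [Module.Finite K V] (p : ℕ) :
    Module.Finite K (⋀[K]^p V ⊗[K] MvPolynomial.homogeneousSubmodule (Fin 2) K p) := by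
  have : Module.Finite K (LinearMap.range (boxIncl K V p)) := by
    rw [← range_monomialSum]; infer_instance
  exact Module.Finite.equiv (LinearEquiv.ofInjective _ (boxIncl_injective p)).symm

variable (K V) in
/-- The map induced by `segre` on the quotient by the quadratic relations. -/
def segreQuot : (ExteriorAlgebra K (V × V) ⧸
      (segreIdeal K (Set.univ : Set V)).restrictScalars K) →ₗ[K]
    ExteriorAlgebra K V ⊗[K] MvPolynomial (Fin 2) K :=
  Submodule.liftQ _ (segre K V).toLinearMap fun _ hx => segre_eq_zero_of_mem hx

lemma segreQuot_sortedWordMap (p : ℕ) (ω : Fin (p + 1) → ⋀[K]^p V) :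
    segreQuot K V (∑ k : Fin (p + 1), sortedWordMap K V p k (ω k)) = monomialSum K V p ω := by
  rw [map_sum, monomialSum_apply]
  refine Finset.sum_congr rfl fun k _ => ?_
  suffices H : segreQuot K V ∘ₗ sortedWordMap K V p k =
      (TensorProduct.mk K _ _).flip (MvPolynomial.monomial (binaryMonomial p k) 1) ∘ₗ
        (⋀[K]^p V).subtype from LinearMap.congr_fun H (ω k)
  apply exteriorPower.linearMap_ext
  ext u
  simp only [LinearMap.compAlternatingMap_apply, LinearMap.comp_apply, sortedWordMap_ιMulti]
  exact segre_sortedWord k u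

lemma exists_sortedWordMap_eq {p : ℕ} {x : ExteriorAlgebra K (V × V)} (hx : x ∈ ⋀[K]^p (V × V)) :
    ∃ ω : Fin (p + 1) → ⋀[K]^p V, Submodule.Quotient.mk x =
      ∑ k : Fin (p + 1), sortedWordMap K V p k (ω k) := by
  have hx' := exteriorPower_le_span_sortedWord p hx
  clear hx
  induction hx' using Submodule.span_induction with
  | mem x hx =>
    obtain ⟨k, hk, u, rfl⟩ := hx
    refine ⟨Pi.single ⟨k, by omega⟩ (exteriorPower.ιMulti K p u), ?_⟩
    rw [Finset.sum_eq_single ⟨k, by omega⟩]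
    · rw [Pi.single_eq_same, sortedWordMap_ιMulti]
    · intro l _ hl; rw [Pi.single_eq_of_ne hl, map_zero]
    · simp
  | zero => exact ⟨0, by simp⟩
  | add x y _ _ h1 h2 =>
    obtain ⟨ω, h1⟩ := h1
    obtain ⟨η, h2⟩ := h2
    exact ⟨ω + η, by simp [h1, h2, Finset.sum_add_distrib]⟩
  | smul c x _ h =>
    obtain ⟨ω, h⟩ := h
    exact ⟨c • ω, by simp [h, Finset.smul_sum]⟩

/-- The kernel of `segre` is generated by the quadratic relations. Modulo these, an element of degree
`p` is a sum of sorted words, `∑ sortedWordMap p k (ω_k)`, and its image `∑ ω_k ⊗ x^k y^(p-k)`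
determines all the `ω_k`. -/
theorem mem_segreIdeal_of_segre_eq_zero {p : ℕ} {x : ExteriorAlgebra K (V × V)}
    (hx : x ∈ ⋀[K]^p (V × V)) (h : segre K V x = 0) : x ∈ segreIdeal K (Set.univ : Set V) := by
  obtain ⟨ω, hω⟩ := exists_sortedWordMap_eq hx
  have h0 : segreQuot K V (Submodule.Quotient.mk x) = 0 := h
  rw [hω, segreQuot_sortedWordMap, ← map_zero (monomialSum K V p)] at h0
  rw [monomialSum_injective p h0] at hω
  simpa using hω

theorem map_segre_exteriorPower (p : ℕ) :
    (⋀[K]^p (V × V)).map (segre K V).toLinearMap = LinearMap.range (boxIncl K V p) := by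
  rw [← range_monomialSum]
  apply le_antisymm
  · rintro _ ⟨x, hx, rfl⟩
    obtain ⟨ω, hω⟩ := exists_sortedWordMap_eq hx
    refine ⟨ω, ?_⟩
    rw [← segreQuot_sortedWordMap, ← hω]; rfl
  · rintro _ ⟨ω, rfl⟩
    rw [monomialSum_apply]
    refine Submodule.sum_mem _ fun k _ => ?_
    have : (⊤ : Submodule K (⋀[K]^p V)) ≤ ((⋀[K]^p (V × V)).map (segre K V).toLinearMap).comap
        ((TensorProduct.mk K _ _).flip (MvPolynomial.monomial (binaryMonomial p k) 1) ∘ₗ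
        (⋀[K]^p V).subtype) := by
      rw [← exteriorPower.ιMulti_span, Submodule.span_le]
      rintro _ ⟨u, rfl⟩
      exact ⟨sortedWord K V p k u, (exteriorPower.ιMulti K p _).2, segre_sortedWord k u⟩
    exact this (Submodule.mem_top (x := ω k))

end Segre

/-! ### The standard representation and its roots -/

/-- Two representations embedded equivariantly in the same space, with the same image, are
isomorphic. The ambient operators `T g` need not form a representation. -/
def equivOfRangeEq {G A B C : Type*} [Monoid G] [AddCommMonoid A] [Module ℚ A]
    [AddCommMonoid B] [Module ℚ B] [AddCommMonoid C] [Module ℚ C] {ρ : Representation ℚ G A}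
    {σ : Representation ℚ G B} (T : G → C →ₗ[ℚ] C) (f : A →ₗ[ℚ] C) (j : B →ₗ[ℚ] C)
    (hf : Function.Injective f) (hj : Function.Injective j)
    (hr : LinearMap.range f = LinearMap.range j) (hfT : ∀ g a, f (ρ g a) = T g (f a))
    (hjT : ∀ g b, j (σ g b) = T g (j b)) : ρ.Equiv σ :=
  let e : A ≃ₗ[ℚ] B := LinearEquiv.ofInjective f hf ≪≫ₗ LinearEquiv.ofEq _ _ hr ≪≫ₗ
    (LinearEquiv.ofInjective j hj).symm
  have he : ∀ a, j (e a) = f a := fun a => congrArg Subtype.val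
    ((LinearEquiv.ofInjective j hj).apply_symm_apply
      (LinearEquiv.ofEq _ _ hr (LinearEquiv.ofInjective f hf a)))
  Representation.Equiv.mk e fun g => LinearMap.ext fun a => hj <| by
    simp only [LinearMap.comp_apply, LinearEquiv.coe_coe]
    rw [he, hjT, he, hfT]

lemma mem_sumZero {n : ℕ} {f : Fin n → ℚ} : f ∈ sumZero n ↔ ∑ i, f i = 0 := by
  simp [sumZero]

/-- The vector `e_i - e_j`. -/
def root {n : ℕ} (i j : Fin n) : sumZero n :=
  ⟨Pi.single i 1 - Pi.single j 1, by simp [mem_sumZero]⟩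

lemma sum_smul_root {n : ℕ} (i₀ : Fin n) (v : sumZero n) : ∑ i, v.1 i • root i i₀ = v := by
  apply Subtype.ext
  funext k
  have hv := mem_sumZero.1 v.2
  simp [root, mul_sub, Finset.sum_sub_distrib, Pi.single_apply, hv]

lemma finrank_sumZero {n : ℕ} (hn : 1 ≤ n) : Module.finrank ℚ (sumZero n) = n - 1 := by
  have hne : (∑ i : Fin n, LinearMap.proj i : (Fin n → ℚ) →ₗ[ℚ] ℚ) ≠ 0 := fun h => by
    have := LinearMap.congr_fun h (Pi.single ⟨0, hn⟩ 1)
    simp at this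
  have := Module.Dual.finrank_ker_add_one_of_ne_zero hne
  rw [Module.finrank_fin_fun] at this
  exact Nat.eq_sub_of_add_eq this

/-- The roots generate all the quadratic relations. The polarization of `u ↦ (u ⊗ x)(u ⊗ y)` at two
roots `e_i - e₀` and `e_j - e₀` is a combination of the relations of these roots and of their
difference `e_i - e_j`; the roots `e_i - e₀` span, so all polarizations are obtained, and every
relation is half of one. -/
lemma segreIdeal_univ_le_roots {n : ℕ} (hn : 1 ≤ n) :
    segreIdeal ℚ (Set.univ : Set (sumZero n)) ≤
      segreIdeal ℚ (Set.range fun ij : Fin n × Fin n => root ij.1 ij.2) := by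
  set J := segreIdeal ℚ (Set.range fun ij : Fin n × Fin n => root ij.1 ij.2) with hJ
  let i₀ : Fin n := ⟨0, hn⟩
  have hroot : ∀ i j, segreRelation ℚ (root i j) ∈ J := fun i j =>
    Ideal.subset_span ⟨_, ⟨(i, j), rfl⟩, rfl⟩
  let B : sumZero n →ₗ[ℚ] sumZero n →ₗ[ℚ] ExteriorAlgebra ℚ (sumZero n × sumZero n) :=
    (LinearMap.mul ℚ _).compl₁₂ (ExteriorAlgebra.ι ℚ ∘ₗ LinearMap.inl ℚ _ _)
      (ExteriorAlgebra.ι ℚ ∘ₗ LinearMap.inr ℚ _ _)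
  have hB : ∀ u, B u u = segreRelation ℚ u := fun u => rfl
  have hpol : ∀ i j, (B + B.flip) (root i i₀) (root j i₀) ∈ J := by
    intro i j
    have e : root i j = root i i₀ - root j i₀ := by
      apply Subtype.ext; simp [root]
    have e2 : (B + B.flip) (root i i₀) (root j i₀) = B (root i i₀) (root i i₀) +
        B (root j i₀) (root j i₀) - B (root i j) (root i j) := by
      rw [e]
      simp only [LinearMap.add_apply, LinearMap.flip_apply, map_sub, LinearMap.sub_apply]
      abel
    rw [e2, hB, hB, hB]
    exact sub_mem (add_mem (hroot _ _) (hroot _ _)) (hroot _ _)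
  have hJsmul : ∀ (c : ℚ) (x), x ∈ J → c • x ∈ J := fun c x hx => by
    rw [Algebra.smul_def]; exact Ideal.mul_mem_left _ _ hx
  rw [segreIdeal, Ideal.span_le]
  rintro _ ⟨u, -, rfl⟩
  have e : segreRelation ℚ u = (1 / 2 : ℚ) • (B + B.flip) u u := by
    rw [LinearMap.add_apply, LinearMap.add_apply, LinearMap.flip_apply, hB]
    module
  rw [e]
  refine hJsmul _ _ ?_
  nth_rewrite 1 [← sum_smul_root i₀ u]
  rw [map_sum, LinearMap.sum_apply]
  refine sum_mem fun i _ => ?_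
  rw [map_smul, LinearMap.smul_apply]
  refine hJsmul _ _ ?_
  rw [← sum_smul_root i₀ u, map_sum]
  refine sum_mem fun j _ => ?_
  rw [map_smul]
  exact hJsmul _ _ (hpol i j)

/-! ### Coordinates on the first cohomology -/

variable {Λ : PeriodPair}

lemma orbitPullback_eq_sum {X : Type} {n : ℕ} (φ : Fin n ≃ X) (f : X →₀ H1E Λ) :
    orbitPullback Λ X f = ∑ i, f (φ i) := by
  have := Fintype.ofEquiv _ φ
  rw [orbitPullback, Finsupp.lsum_apply, Finsupp.sum_fintype _ _ fun _ => rfl]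
  exact (Equiv.sum_comp φ fun x => f x).symm

/-- The coefficients of `x` (for `k = 0`) or of `y` (for `k = 1`) of a class in `H¹(E^X / E)`; their
sum vanishes because the class vanishes on the orbits. -/
def h1Coord {X : Type} {n : ℕ} (φ : Fin n ≃ X) (k : Fin 2) : H1 Λ X →ₗ[ℚ] sumZero n :=
  LinearMap.codRestrict (sumZero n)
    (LinearMap.pi fun i => (xyBasis Λ).coord k ∘ₗ Finsupp.lapply (φ i) ∘ₗ (H1 Λ X).subtype)
    fun f => by
      rw [mem_sumZero]
      have hf : orbitPullback Λ X f.1 = 0 := f.2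
      rw [orbitPullback_eq_sum φ] at hf
      simpa using congrArg ((xyBasis Λ).coord k) hf

lemma h1Coord_apply {X : Type} {n : ℕ} (φ : Fin n ≃ X) (k : Fin 2) (f : H1 Λ X) (i : Fin n) :
    (h1Coord φ k f).1 i = (xyBasis Λ).repr (f.1 (φ i)) k := rfl

/-- The isomorphism of `H¹(E^n / E)` with `V(1) ⊗ ℚ²`, encoded as `V(1) × V(1)`. -/
def h1Equiv {X : Type} {n : ℕ} (φ : Fin n ≃ X) : H1 Λ X ≃ₗ[ℚ] sumZero n × sumZero n :=
  LinearEquiv.ofBijective ((h1Coord φ 0).prod (h1Coord φ 1)) <| by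
    constructor
    · rw [injective_iff_map_eq_zero]
      intro f hf
      apply Subtype.ext
      ext1 x
      obtain ⟨i, rfl⟩ := φ.surjective x
      apply (xyBasis Λ).repr.injective
      ext1 k
      have h0 : (h1Coord φ 0 f).1 i = 0 := congrArg (fun z => z.1.1 i) hf
      have h1 : (h1Coord φ 1 f).1 i = 0 := congrArg (fun z => z.2.1 i) hf
      rw [h1Coord_apply] at h0 h1
      fin_cases k
      · simpa using h0
      · simpa using h1
    · rintro ⟨a, b⟩
      let g : X →₀ H1E Λ :=
        ∑ i, Finsupp.single (φ i) (a.1 i • xyBasis Λ 0 + b.1 i • xyBasis Λ 1)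
      have hg : ∀ i, g (φ i) = a.1 i • xyBasis Λ 0 + b.1 i • xyBasis Λ 1 := by
        intro i
        rw [Finsupp.finsetSum_apply, Finset.sum_eq_single i]
        · simp
        · intro j _ hj
          exact Finsupp.single_eq_of_ne (φ.injective.ne hj.symm)
        · simp
      refine ⟨⟨g, ?_⟩, ?_⟩
      · change orbitPullback Λ X g = 0
        rw [orbitPullback_eq_sum φ]
        simp only [hg, Finset.sum_add_distrib, ← Finset.sum_smul, mem_sumZero.1 a.2,
          mem_sumZero.1 b.2, zero_smul, add_zero]
      · refine Prod.ext (Subtype.ext (funext fun i => ?_)) (Subtype.ext (funext fun i => ?_))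
        · change (h1Coord φ 0 _).1 i = _
          rw [h1Coord_apply, hg]; simp
        · change (h1Coord φ 1 _).1 i = _
          rw [h1Coord_apply, hg]; simp

lemma h1Equiv_apply {X : Type} {n : ℕ} (φ : Fin n ≃ X) (f : H1 Λ X) :
    h1Equiv φ f = (h1Coord φ 0 f, h1Coord φ 1 f) := rfl

lemma h1Coord_delta {X : Type} {n : ℕ} (φ : Fin n ≃ X) (k : Fin 2) (i j : Fin n) (h : H1E Λ) :
    h1Coord φ k (delta (φ i) (φ j) h) = (xyBasis Λ).repr h k • root i j := by
  apply Subtype.ext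
  funext l
  rw [h1Coord_apply, delta_coe]
  by_cases hi : i = l <;> by_cases hj : j = l <;>
    simp [root, hi, hj, Ne.symm]

lemma map_h1Equiv_divisorClass {X : Type} {n : ℕ} (φ : Fin n ≃ X) (i j : Fin n) :
    ExteriorAlgebra.map (h1Equiv φ).toLinearMap (divisorClass (Λ := Λ) (φ i) (φ j)) =
      segreRelation ℚ (root i j) := by
  simp [divisorClass, segreRelation, h1Equiv_apply, h1Coord_delta]

/-- The action of `T ⊗ A` on `V ⊗ ℚ²`, encoded as `V × V`. -/
def slPair {V : Type*} [AddCommGroup V] [Module ℚ V] (A : SL2) (T : V →ₗ[ℚ] V) :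
    V × V →ₗ[ℚ] V × V :=
  (A.1 0 0 • T ∘ₗ LinearMap.fst ℚ V V + A.1 0 1 • T ∘ₗ LinearMap.snd ℚ V V).prod
    (A.1 1 0 • T ∘ₗ LinearMap.fst ℚ V V + A.1 1 1 • T ∘ₗ LinearMap.snd ℚ V V)

lemma slPair_apply {V : Type*} [AddCommGroup V] [Module ℚ V] (A : SL2) (T : V →ₗ[ℚ] V)
    (a b : V) : slPair A T (a, b) =
      (A.1 0 0 • T a + A.1 0 1 • T b, A.1 1 0 • T a + A.1 1 1 • T b) := rfl

lemma h1Equiv_H1map {X Y : Type} {n : ℕ} (φ : Fin n ≃ X) (ψ : Fin n ≃ Y) (A : SL2)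
    (π : Equiv.Perm (Fin n)) (m : X → Y) (hm : ∀ i, m (φ i) = ψ (π i)) (f : H1 Λ X) :
    h1Equiv ψ (H1map (slRep Λ A) m f) = slPair A (stdRep n π) (h1Equiv φ f) := by
  have hminj : Function.Injective m := by
    intro x y h
    obtain ⟨i, rfl⟩ := φ.surjective x
    obtain ⟨j, rfl⟩ := φ.surjective y
    rw [hm, hm] at h
    rw [π.injective (ψ.injective h)]
  have key : ∀ (k : Fin 2) (i : Fin n), (h1Coord ψ k (H1map (slRep Λ A) m f)).1 i =
      A.1 k 0 * (h1Coord φ 0 f).1 (π.symm i) + A.1 k 1 * (h1Coord φ 1 f).1 (π.symm i) := by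
    intro k i
    obtain ⟨i, rfl⟩ := π.surjective i
    rw [h1Coord_apply, H1map_coe, ← hm, Finsupp.mapDomain_apply hminj, Equiv.symm_apply_apply]
    change (xyBasis Λ).repr (Matrix.toLin (xyBasis Λ) (xyBasis Λ) A.1 (f.1 (φ i))) k = _
    rw [Matrix.repr_toLin, Matrix.mulVec, dotProduct, Fin.sum_univ_two]
    rfl
  refine Prod.ext (Subtype.ext (funext fun i => ?_)) (Subtype.ext (funext fun i => ?_))
  · exact key 0 i
  · exact key 1 i

lemma segre_map_slPair {V : Type*} [AddCommGroup V] [Module ℚ V] (A : SL2) (T : V →ₗ[ℚ] V)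
    (x : ExteriorAlgebra ℚ (V × V)) :
    segre ℚ V (ExteriorAlgebra.map (slPair A T) x) =
      Algebra.TensorProduct.map (ExteriorAlgebra.map T) (polyAct A) (segre ℚ V x) := by
  suffices H : (segre ℚ V).comp (ExteriorAlgebra.map (slPair A T)) =
      (Algebra.TensorProduct.map (ExteriorAlgebra.map T) (polyAct A)).comp (segre ℚ V) from
    DFunLike.congr_fun H x
  apply ExteriorAlgebra.hom_ext
  ext1
  all_goals
    ext a
    simp only [LinearMap.comp_apply, AlgHom.toLinearMap_apply, AlgHom.comp_apply,
      ExteriorAlgebra.map_apply_ι, slPair_apply, LinearMap.inl_apply, LinearMap.inr_apply,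
      segre_ι, Algebra.TensorProduct.map_tmul, polyAct, MvPolynomial.aeval_X, Fin.sum_univ_two,
      map_zero, smul_zero, add_zero, zero_add, map_smul, TensorProduct.zero_tmul,
      TensorProduct.tmul_add, MvPolynomial.C_mul', TensorProduct.tmul_smul,
      TensorProduct.smul_tmul']

/-! ### Layers of rank zero and one -/

/-- The blocks of a layer of rank zero are the coordinates. -/
def blockEquiv {n : ℕ} {s : Setoid (Fin n)} (hs : rk s = 0) : Fin n ≃ Quotient s :=
  Equiv.ofBijective (Quotient.mk s) <|
    Quotient.mk_surjective.bijective_of_nat_card_le <| by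
      have := card_le s
      unfold rk at hs
      rw [Nat.card_eq_fintype_card, Fintype.card_fin]
      omega

lemma blockEquiv_apply {n : ℕ} {s : Setoid (Fin n)} (hs : rk s = 0) (i : Fin n) :
    blockEquiv hs i = Quotient.mk s i := rfl

lemma eq_of_rk_eq_zero {n : ℕ} {s : Setoid (Fin n)} (hs : rk s = 0) {i j : Fin n} (h : s i j) :
    i = j :=
  (blockEquiv hs).injective (Quotient.sound h)

instance (n : ℕ) : Subsingleton (Layer n 0) where
  allEq r s := Subtype.ext <| Setoid.ext fun i _ =>
    ⟨fun h => eq_of_rk_eq_zero r.2 h ▸ s.1.refl i, fun h => eq_of_rk_eq_zero s.2 h ▸ r.1.refl i⟩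

lemma exists_layer_zero (n : ℕ) : Nonempty (Layer n 0) := by
  refine ⟨⟨⊥, ?_⟩⟩
  have h : Function.Injective (Quotient.mk (⊥ : Setoid (Fin n))) := fun i j h =>
    Quotient.exact h
  have := Nat.card_le_card_of_injective _ h
  simp only [Nat.card_eq_fintype_card (α := Fin n), Fintype.card_fin] at this
  unfold rk
  omega

/-- The partition whose only block with more than one element is `{i, j}`, as the kernel of the map
that sends `j` to `i` and fixes the other coordinates. -/
def mergeSetoid {n : ℕ} (i j : Fin n) : Setoid (Fin n) :=
  Setoid.ker fun k => if k = j then i else k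

lemma mergeSetoid_rel {n : ℕ} (i j : Fin n) : mergeSetoid i j i j := by
  change (if i = j then i else i) = if j = j then i else j
  simp

lemma rk_mergeSetoid {n : ℕ} {i j : Fin n} (hij : i ≠ j) : rk (mergeSetoid i j) = 1 := by
  have hr : Set.range (fun k => if k = j then i else k) = {j}ᶜ := by
    ext k
    simp only [Set.mem_range, Set.mem_compl_iff, Set.mem_singleton_iff]
    constructor
    · rintro ⟨l, rfl⟩
      split_ifs with h
      · exact hij
      · exact h
    · exact fun h => ⟨k, if_neg h⟩
  have hc : Nat.card (Quotient (mergeSetoid i j)) = n - 1 := by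
    rw [mergeSetoid,
      Nat.card_congr (Setoid.quotientKerEquivRange fun k => if k = j then i else k), hr,
      Nat.card_coe_set_eq, Set.ncard_compl]
    simp
  have := i.2
  unfold rk
  omega

/-! ### Orlik-Solomon algebras in degrees zero and one -/

/-- The component of degree zero of an element of the Orlik-Solomon algebra. -/
def augmentation {n : ℕ} (s : Setoid (Fin n)) : (FreeOS s ⧸ OSideal s) →ₗ[ℚ] ℚ :=
  (OSideal s).liftQ (ExteriorAlgebra.algebraMapInv (R := ℚ)).toLinearMap <| by
    have : Ideal.span {x | ∃ i j k, x = arnold s i j k} ≤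
        RingHom.ker (ExteriorAlgebra.algebraMapInv (R := ℚ) (M := Edge s →₀ ℚ)) := by
      rw [Ideal.span_le]
      rintro _ ⟨i, j, k, rfl⟩
      simp [arnold, gen, ExteriorAlgebra.algebraMapInv]
    exact fun x hx => this hx

lemma augmentation_mk {n : ℕ} (s : Setoid (Fin n)) (x : FreeOS s) :
    augmentation s ((OSideal s).mkQ x) = ExteriorAlgebra.algebraMapInv x := rfl

lemma augmentation_osMap {n : ℕ} (π : Equiv.Perm (Fin n)) {s t : Setoid (Fin n)}
    (h : ∀ i j, t (π i) (π j) → s i j) (q : ℕ) (ω : OS s q) :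
    augmentation t (osMap π h q ω).1 = augmentation s ω.1 := by
  obtain ⟨_, x, hx, rfl⟩ := ω
  change ExteriorAlgebra.algebraMapInv (ExteriorAlgebra.map (edgeMap π s t) x) =
    ExteriorAlgebra.algebraMapInv x
  rw [← AlgHom.comp_apply]
  congr 1
  apply ExteriorAlgebra.hom_ext
  ext v
  simp [ExteriorAlgebra.algebraMapInv]

/-- The unit of the Orlik-Solomon algebra. -/
def osOne {n : ℕ} (s : Setoid (Fin n)) : OS s 0 :=
  ⟨(OSideal s).mkQ 1, 1, by
    rw [ExteriorAlgebra.exteriorPower, pow_zero]; exact Submodule.one_le.1 le_rfl, rfl⟩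

lemma augmentation_osOne {n : ℕ} (s : Setoid (Fin n)) : augmentation s (osOne s).1 = 1 := by
  change augmentation s ((OSideal s).mkQ 1) = 1
  rw [augmentation_mk, map_one]

lemma eq_smul_osOne {n : ℕ} {s : Setoid (Fin n)} (ω : OS s 0) : ∃ c : ℚ, ω = c • osOne s := by
  obtain ⟨_, x, hx, rfl⟩ := ω
  rw [ExteriorAlgebra.exteriorPower, pow_zero, SetLike.mem_coe, Submodule.mem_one] at hx
  obtain ⟨c, rfl⟩ := hx
  refine ⟨c, Subtype.ext ?_⟩
  change (OSideal s).mkQ _ = c • (OSideal s).mkQ 1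
  rw [← map_smul, Algebra.algebraMap_eq_smul_one]

/-- The class of the generator `ω_{ij}`. -/
def osGen {n : ℕ} (s : Setoid (Fin n)) (i j : Fin n) : OS s 1 :=
  ⟨(OSideal s).mkQ (gen s i j), gen s i j, by
    rw [ExteriorAlgebra.exteriorPower, pow_one]; exact ⟨_, rfl⟩, rfl⟩

lemma sigma_osGen {n : ℕ} {r s : Setoid (Fin n)} (hrs : r ≤ s) {i j : Fin n} (hij : i ≠ j)
    (h : s i j) : sigma 0 hrs (osGen s i j) = osOne r := by
  apply Subtype.ext
  change (OSideal r).mkQ (ExteriorAlgebra.map (edgeMap 1 s r) (bdry s (gen s i j))) =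
    (OSideal r).mkQ 1
  have := bdry_ι_mul s (edgeVec s s(i, j)) 1
  rw [mul_one, total_edgeVec hij h, one_smul, ← map_one (algebraMap ℚ (FreeOS s)),
    bdry_algebraMap, mul_zero, sub_zero, map_one] at this
  rw [gen, this, map_one]

/-! ### Homogeneous elements of left ideals -/

/-- A homogeneous element of degree `p` of a left ideal generated by elements of degree two is a
combination of the generators with coefficients of degree `p - 2`; it is zero if `p < 2`. -/
lemma mem_span_of_mem_ideal_span_of_mem_exteriorPower {M : Type*} [AddCommGroup M] [Module ℚ M]
    {S : Set (ExteriorAlgebra ℚ M)} (hS : S ⊆ ⋀[ℚ]^2 M) {x : ExteriorAlgebra ℚ M}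
    (hx : x ∈ Ideal.span S) {p : ℕ} (hxp : x ∈ ⋀[ℚ]^p M) :
    x ∈ Submodule.span ℚ {z | 2 ≤ p ∧ ∃ a ∈ ⋀[ℚ]^(p - 2) M, ∃ δ ∈ S, z = a * δ} := by
  suffices H : (DirectSum.decompose (fun i : ℕ => ⋀[ℚ]^i M) x p : ExteriorAlgebra ℚ M) ∈
      Submodule.span ℚ {z | 2 ≤ p ∧ ∃ a ∈ ⋀[ℚ]^(p - 2) M, ∃ δ ∈ S, z = a * δ} by
    rwa [DirectSum.decompose_of_mem_same (fun i : ℕ => ⋀[ℚ]^i M) hxp] at H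
  clear hxp
  induction hx using Submodule.closure_induction with
  | zero => simp
  | add x y _ _ h1 h2 => rw [DirectSum.decompose_add]; exact add_mem h1 h2
  | smul_mem a δ hδ =>
    rw [smul_eq_mul, DirectSum.coe_decompose_mul_of_right_mem (fun i : ℕ => ⋀[ℚ]^i M) p (hS hδ)]
    split_ifs with hp
    · exact Submodule.subset_span ⟨hp, _, SetLike.coe_mem _, δ, hδ, rfl⟩
    · exact zero_mem _

/-! ### The bottom row of the third page -/

variable (Λ) in
/-- The map `segre` in the coordinates `h1Equiv`. -/
def layerSegre {n : ℕ} {s : Setoid (Fin n)} (hs : rk s = 0) :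
    ExteriorAlgebra ℚ (H1 Λ (Quotient s)) →ₐ[ℚ]
      ExteriorAlgebra ℚ (sumZero n) ⊗[ℚ] MvPolynomial (Fin 2) ℚ :=
  (segre ℚ (sumZero n)).comp (ExteriorAlgebra.map (h1Equiv (blockEquiv hs)).toLinearMap)

lemma layerSegre_divisorClass {n : ℕ} {s : Setoid (Fin n)} (hs : rk s = 0) (i j : Fin n) :
    layerSegre Λ hs (divisorClass (Quotient.mk s i) (Quotient.mk s j)) = 0 := by
  rw [layerSegre, AlgHom.comp_apply, ← blockEquiv_apply hs, ← blockEquiv_apply hs,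
    map_h1Equiv_divisorClass, segre_segreRelation]

lemma layerSegre_equivariant {n : ℕ} {s t : Setoid (Fin n)} (hs : rk s = 0) (ht : rk t = 0)
    (A : SL2) (π : Equiv.Perm (Fin n)) (h : ∀ i j, s i j → t (π i) (π j))
    (x : ExteriorAlgebra ℚ (H1 Λ (Quotient s))) :
    layerSegre Λ ht (ExteriorAlgebra.map (H1map (slRep Λ A) (blockMap π h)) x) =
      Algebra.TensorProduct.map (ExteriorAlgebra.map (stdRep n π)) (polyAct A)
        (layerSegre Λ hs x) := by
  rw [layerSegre, layerSegre, AlgHom.comp_apply, AlgHom.comp_apply, ← segre_map_slPair]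
  have e : (ExteriorAlgebra.map (h1Equiv (blockEquiv ht)).toLinearMap).comp
      (ExteriorAlgebra.map (H1map (slRep Λ A) (blockMap π h))) =
      (ExteriorAlgebra.map (slPair A (stdRep n π))).comp
        (ExteriorAlgebra.map (h1Equiv (blockEquiv hs)).toLinearMap) := by
    rw [ExteriorAlgebra.map_comp_map, ExteriorAlgebra.map_comp_map]
    congr 1
    ext1 f
    exact h1Equiv_H1map (blockEquiv hs) (blockEquiv ht) A π _ (fun _ => rfl) f
  exact congrArg (segre ℚ (sumZero n)) (DFunLike.congr_fun e x)

lemma exteriorAlgebra_map_mem {M N : Type*} [AddCommGroup M] [Module ℚ M] [AddCommGroup N]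
    [Module ℚ N] (f : M →ₗ[ℚ] N) {p : ℕ} {x : ExteriorAlgebra ℚ M} (hx : x ∈ ⋀[ℚ]^p M) :
    ExteriorAlgebra.map f x ∈ ⋀[ℚ]^p N := by
  have := (exteriorPower.map p f ⟨x, hx⟩).2
  rwa [exteriorPower_map_coe] at this

lemma map_layerSegre_exteriorPower {n : ℕ} {s : Setoid (Fin n)} (hs : rk s = 0) (p : ℕ) :
    (⋀[ℚ]^p (H1 Λ (Quotient s))).map (layerSegre Λ hs).toLinearMap =
      LinearMap.range (boxIncl ℚ (sumZero n) p) := by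
  rw [← map_segre_exteriorPower]
  apply le_antisymm
  · rintro _ ⟨x, hx, rfl⟩
    exact ⟨_, exteriorAlgebra_map_mem _ hx, rfl⟩
  · rintro _ ⟨x, hx, rfl⟩
    refine ⟨_, exteriorAlgebra_map_mem (h1Equiv (blockEquiv hs)).symm.toLinearMap hx, ?_⟩
    change segre ℚ _ (ExteriorAlgebra.map _ (ExteriorAlgebra.map _ x)) = segre ℚ _ x
    rw [← AlgHom.comp_apply (ExteriorAlgebra.map _), ExteriorAlgebra.map_comp_map,
      LinearEquiv.comp_symm, ExteriorAlgebra.map_id]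
    rfl

/-- The kernel of `layerSegre` is generated by the divisor classes. -/
lemma mem_span_of_layerSegre_eq_zero {n : ℕ} {s : Setoid (Fin n)} (hs : rk s = 0)
    {p : ℕ} {x : ExteriorAlgebra ℚ (H1 Λ (Quotient s))} (hx : x ∈ ⋀[ℚ]^p (H1 Λ (Quotient s)))
    (h : layerSegre Λ hs x = 0) (hn : 1 ≤ n) :
    x ∈ Submodule.span ℚ {z | 2 ≤ p ∧ ∃ a ∈ ⋀[ℚ]^(p - 2) (H1 Λ (Quotient s)),
      ∃ i j, z = a * divisorClass (Quotient.mk s i) (Quotient.mk s j)} := by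
  have h1 := segreIdeal_univ_le_roots hn
    (mem_segreIdeal_of_segre_eq_zero (exteriorAlgebra_map_mem _ hx) h)
  have h2 : x ∈ Ideal.span (Set.range fun ij : Fin n × Fin n =>
      divisorClass (Λ := Λ) (Quotient.mk s ij.1) (Quotient.mk s ij.2)) := by
    set e := h1Equiv (Λ := Λ) (blockEquiv hs)
    have hx' : x = ExteriorAlgebra.map e.symm.toLinearMap
        (ExteriorAlgebra.map e.toLinearMap x) := by
      rw [← AlgHom.comp_apply, ExteriorAlgebra.map_comp_map, LinearEquiv.symm_comp,
        ExteriorAlgebra.map_id]; rfl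
    rw [hx']
    have hle : segreIdeal ℚ (Set.range fun ij : Fin n × Fin n => root ij.1 ij.2) ≤
        (Ideal.span (Set.range fun ij : Fin n × Fin n => divisorClass (Λ := Λ)
          (Quotient.mk s ij.1) (Quotient.mk s ij.2))).comap
          (ExteriorAlgebra.map e.symm.toLinearMap) := by
      rw [segreIdeal, Ideal.span_le]
      rintro _ ⟨_, ⟨⟨i, j⟩, rfl⟩, rfl⟩
      rw [SetLike.mem_coe, Ideal.mem_comap]
      refine Ideal.subset_span ⟨(i, j), ?_⟩
      simp only
      rw [← map_h1Equiv_divisorClass (Λ := Λ) (blockEquiv hs), ← AlgHom.comp_apply,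
        ExteriorAlgebra.map_comp_map, LinearEquiv.symm_comp, ExteriorAlgebra.map_id]
      rfl
    exact hle h1
  refine Submodule.span_mono ?_ (mem_span_of_mem_ideal_span_of_mem_exteriorPower ?_ h2 hx)
  · rintro _ ⟨hp, a, ha, _, ⟨⟨i, j⟩, rfl⟩, rfl⟩
    exact ⟨hp, a, ha, i, j, rfl⟩
  · rintro _ ⟨⟨i, j⟩, rfl⟩
    have := mul_mem_two 0 (delta (Quotient.mk s i) (Quotient.mk s j) (xyBasis Λ 0))
      (delta (Quotient.mk s i) (Quotient.mk s j) (xyBasis Λ 1)) 1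
      (by rw [ExteriorAlgebra.exteriorPower, pow_zero]; exact Submodule.one_le.1 le_rfl)
    rwa [one_mul] at this

variable (Λ) in
/-- The map `x ⊗ ω ↦ ω • layerSegre x` on a summand with `q = 0`, where `ω` is a scalar. -/
def summandSegre {n : ℕ} (p : ℕ) {s : Setoid (Fin n)} (hs : rk s = 0) :
    Summand Λ p 0 s →ₗ[ℚ] ExteriorAlgebra ℚ (sumZero n) ⊗[ℚ] MvPolynomial (Fin 2) ℚ :=
  (TensorProduct.rid ℚ _).toLinearMap ∘ₗ TensorProduct.map
    ((layerSegre Λ hs).toLinearMap ∘ₗ (⋀[ℚ]^p (H1 Λ (Quotient s))).subtype)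
    (augmentation s ∘ₗ (OS s 0).subtype)

lemma summandSegre_tmul {n : ℕ} (p : ℕ) {s : Setoid (Fin n)} (hs : rk s = 0)
    (x : ⋀[ℚ]^p (H1 Λ (Quotient s))) (ω : OS s 0) :
    summandSegre Λ p hs (x ⊗ₜ[ℚ] ω : ⋀[ℚ]^p (H1 Λ (Quotient s)) ⊗[ℚ] OS s 0) =
      augmentation s ω.1 • layerSegre Λ hs x.1 := rfl

lemma summandSegre_summandMap {n : ℕ} (p : ℕ) (g : Equiv.Perm (Fin n) × SL2)
    {s t : Setoid (Fin n)} (hs : rk s = 0) (ht : rk t = 0) (h : Carries g.1 s t)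
    (z : Summand Λ p 0 s) :
    summandSegre Λ p ht (summandMap p 0 g h z) =
      Algebra.TensorProduct.map (ExteriorAlgebra.map (stdRep n g.1)) (polyAct g.2)
        (summandSegre Λ p hs z) := by
  suffices H : summandSegre Λ p ht ∘ₗ summandMap p 0 g h =
      (Algebra.TensorProduct.map (ExteriorAlgebra.map (stdRep n g.1)) (polyAct g.2)).toLinearMap
        ∘ₗ summandSegre Λ p hs from LinearMap.congr_fun H z
  refine TensorProduct.ext' fun x ω => ?_
  change augmentation _ (osMap g.1 (fun i j => (h i j).2) 0 ω).1 •
      layerSegre Λ _ (exteriorPower.map p _ x).1 =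
    (Algebra.TensorProduct.map _ _) (augmentation s ω.1 • layerSegre Λ hs x.1)
  rw [augmentation_osMap, exteriorPower_map_coe, layerSegre_equivariant hs, map_smul]

lemma summandSegre_dSummand {n : ℕ} (p : ℕ) {r s : Setoid (Fin n)} (hr : rk r = 0)
    (hrs : r ≤ s) (hrk : rk s = rk r + 1) (z : Summand Λ p 1 s) :
    summandSegre Λ (p + 2) hr (dSummand p 0 hrs hrk z) = 0 := by
  suffices H : summandSegre Λ (p + 2) hr ∘ₗ dSummand p 0 hrs hrk = 0 from LinearMap.congr_fun H z
  refine TensorProduct.ext' fun b ω => ?_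
  refine (summandSegre_tmul (p + 2) hr (gysin p hrk b) (sigma 0 hrs ω)).trans ?_
  obtain ⟨a, rfl⟩ := restrict_surjective hrs p b
  obtain ⟨⟨i, j⟩, h1, h2⟩ := exists_merged hrk
  rw [gysin_restrict p hrs hrk h1 h2, map_mul, layerSegre_divisorClass, mul_zero, smul_zero]
  rfl

lemma exists_tmul_osOne {n : ℕ} (p : ℕ) {s : Setoid (Fin n)}
    (z : ⋀[ℚ]^p (H1 Λ (Quotient s)) ⊗[ℚ] OS s 0) : ∃ x, x ⊗ₜ[ℚ] osOne s = z := by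
  induction z using TensorProduct.induction_on with
  | zero => exact ⟨0, TensorProduct.zero_tmul _ _⟩
  | add z w hz hw =>
    obtain ⟨x, rfl⟩ := hz
    obtain ⟨y, rfl⟩ := hw
    exact ⟨x + y, TensorProduct.add_tmul _ _ _⟩
  | tmul x ω =>
    obtain ⟨c, rfl⟩ := eq_smul_osOne ω
    exact ⟨c • x, TensorProduct.smul_tmul _ _ _⟩

open scoped Classical in
variable (Λ) in
/-- The map induced by `segre` on the bottom row of the second page. -/
def pageSegre (n p : ℕ) :
    E2 Λ n p 0 →ₗ[ℚ] ExteriorAlgebra ℚ (sumZero n) ⊗[ℚ] MvPolynomial (Fin 2) ℚ :=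
  DirectSum.toModule ℚ (Layer n 0) _ fun s => summandSegre Λ p s.2

open scoped Classical in
lemma pageSegre_lof (n p : ℕ) (s : Layer n 0) (x : Summand Λ p 0 s.1) :
    pageSegre Λ n p (DirectSum.lof ℚ (Layer n 0) (fun s => Summand Λ p 0 s.1) s x) =
      summandSegre Λ p s.2 x := by
  rw [pageSegre, DirectSum.toModule_lof]

lemma pageSegre_equivariant (n p : ℕ) (g : Equiv.Perm (Fin n) × SL2) (y : E2 Λ n p 0) :
    pageSegre Λ n p (E2Rep Λ n p 0 g y) =
      Algebra.TensorProduct.map (ExteriorAlgebra.map (stdRep n g.1)) (polyAct g.2)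
        (pageSegre Λ n p y) := by
  classical
  suffices H : pageSegre Λ n p ∘ₗ E2map p 0 g =
      (Algebra.TensorProduct.map (ExteriorAlgebra.map (stdRep n g.1)) (polyAct g.2)).toLinearMap
        ∘ₗ pageSegre Λ n p from LinearMap.congr_fun H y
  apply DirectSum.linearMap_ext
  intro s
  apply LinearMap.ext
  intro z
  simp only [LinearMap.comp_apply]
  rw [E2map_lof]
  refine (pageSegre_lof n p (actLayer g.1 s) _).trans ?_
  rw [pageSegre_lof]
  exact summandSegre_summandMap p g s.2 _ _ z

open scoped Classical in
variable (Λ) in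
/-- The class `x ⊗ 1` in the summand of `r`, the only layer of rank zero. -/
def pureClass {n : ℕ} (p : ℕ) (r : Layer n 0) : ⋀[ℚ]^p (H1 Λ (Quotient r.1)) →ₗ[ℚ] E2 Λ n p 0 :=
  DirectSum.lof ℚ (Layer n 0) (fun s => Summand Λ p 0 s.1) r ∘ₗ
    (TensorProduct.mk ℚ (⋀[ℚ]^p (H1 Λ (Quotient r.1))) (OS r.1 0)).flip (osOne r.1)

lemma pageSegre_pureClass {n : ℕ} (p : ℕ) (r : Layer n 0) (x : ⋀[ℚ]^p (H1 Λ (Quotient r.1))) :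
    pageSegre Λ n p (pureClass Λ p r x) = layerSegre Λ r.2 x.1 := by
  classical
  refine (pageSegre_lof n p r _).trans ?_
  refine (summandSegre_tmul p r.2 x (osOne r.1)).trans ?_
  rw [augmentation_osOne, one_smul]

lemma pureClass_surjective {n : ℕ} (p : ℕ) (r : Layer n 0) :
    Function.Surjective (pureClass Λ p r) := by
  classical
  rw [← LinearMap.range_eq_top, eq_top_iff]
  intro y _
  induction y using DirectSum.induction_on with
  | zero => exact zero_mem _
  | add x y hx hy => exact add_mem (hx trivial) (hy trivial)
  | of s z =>
    obtain rfl : s = r := Subsingleton.elim _ _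
    obtain ⟨x, rfl⟩ := exists_tmul_osOne p z
    exact ⟨x, rfl⟩

lemma range_pageSegre (n p : ℕ) :
    LinearMap.range (pageSegre Λ n p) = LinearMap.range (boxIncl ℚ (sumZero n) p) := by
  obtain ⟨r⟩ := exists_layer_zero n
  rw [← map_layerSegre_exteriorPower (Λ := Λ) r.2]
  apply le_antisymm
  · rintro _ ⟨y, rfl⟩
    obtain ⟨x, rfl⟩ := pureClass_surjective p r y
    exact ⟨x.1, x.2, (pageSegre_pureClass p r x).symm⟩
  · rintro _ ⟨x, hx, rfl⟩
    exact ⟨pureClass Λ p r ⟨x, hx⟩, pageSegre_pureClass p r ⟨x, hx⟩⟩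

lemma pageSegre_d (n p : ℕ) (y : E2 Λ n p 1) : pageSegre Λ n (p + 2) (d Λ n p 0 y) = 0 := by
  classical
  suffices H : pageSegre Λ n (p + 2) ∘ₗ d Λ n p 0 = 0 from LinearMap.congr_fun H y
  apply DirectSum.linearMap_ext
  intro s
  apply LinearMap.ext
  intro z
  simp only [LinearMap.comp_apply]
  rw [d_lof, map_sum]
  refine Finset.sum_eq_zero fun r _ => ?_
  split_ifs with h
  · exact (pageSegre_lof n (p + 2) r _).trans (summandSegre_dSummand p r.2 h _ z)
  · rw [map_zero]

/-- The class `a · [D_{ij}] ⊗ 1` is the differential of `γ^* a ⊗ ω_{ij}` in the summand of the divisor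
`D_{ij}`, where `γ^*` is the restriction to the divisor. -/
lemma pureClass_mul_divisorClass_mem {n : ℕ} (p : ℕ) (r : Layer n 0) (i j : Fin n)
    (a : ⋀[ℚ]^p (H1 Λ (Quotient r.1))) (x : ⋀[ℚ]^(p + 2) (H1 Λ (Quotient r.1)))
    (hx : x.1 = a.1 * divisorClass (Quotient.mk r.1 i) (Quotient.mk r.1 j)) :
    pureClass Λ (p + 2) r x ∈ LinearMap.range (d Λ n p 0) := by
  classical
  by_cases hij : i = j
  · have : x = 0 := Subtype.ext <| by
      have h0 : delta (Λ := Λ) (Quotient.mk r.1 j) (Quotient.mk r.1 j) (xyBasis Λ 0) = 0 :=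
        Subtype.ext (by simp [delta_coe])
      rw [hx, hij, divisorClass, h0, map_zero, zero_mul, mul_zero]; rfl
    rw [this, map_zero]
    exact zero_mem _
  · let s : Layer n 1 := ⟨mergeSetoid i j, rk_mergeSetoid hij⟩
    have hrs : r.1 ≤ s.1 := fun {k l} h => eq_of_rk_eq_zero r.2 h ▸ s.1.refl k
    have hrk : rk s.1 = rk r.1 + 1 := s.2.trans (congrArg (· + 1) r.2.symm)
    refine ⟨DirectSum.lof ℚ (Layer n 1) (fun s => Summand Λ p 1 s.1) s
      (exteriorPower.map p (H1map LinearMap.id (coarsen hrs)) a ⊗ₜ[ℚ] osGen s.1 i j), ?_⟩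
    refine (d_lof p 0 s _).trans ?_
    rw [Fintype.sum_subsingleton _ r, dif_pos hrs]
    refine congrArg (DirectSum.lof ℚ (Layer n 0) (fun s => Summand Λ (p + 2) 0 s.1) r) ?_
    change gysin p hrk _ ⊗ₜ[ℚ] sigma 0 hrs _ = x ⊗ₜ[ℚ] osOne r.1
    rw [sigma_osGen hrs hij (mergeSetoid_rel i j)]
    congr 1
    apply Subtype.ext
    rw [hx]
    exact gysin_restrict p hrs hrk (mergeSetoid_rel i j) (fun h => hij (eq_of_rk_eq_zero r.2 h)) a

/-- The boundaries of the bottom row are the degree `p` part of the ideal generated by the divisor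
classes, that is, the kernel of `segre`. -/
lemma ker_pageSegre {n : ℕ} (hn : 1 ≤ n) (p : ℕ) :
    LinearMap.ker (pageSegre Λ n p) = boundaries Λ n p 0 := by
  obtain ⟨r⟩ := exists_layer_zero n
  apply le_antisymm
  · intro y hy
    obtain ⟨x, rfl⟩ := pureClass_surjective p r y
    rw [LinearMap.mem_ker, pageSegre_pureClass] at hy
    have hspan := mem_span_of_layerSegre_eq_zero r.2 x.2 hy hn
    have hle : Submodule.span ℚ {z | 2 ≤ p ∧ ∃ a ∈ ⋀[ℚ]^(p - 2) (H1 Λ (Quotient r.1)),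
        ∃ i j, z = a * divisorClass (Quotient.mk r.1 i) (Quotient.mk r.1 j)} ≤
        ((boundaries Λ n p 0).comap (pureClass Λ p r)).map (Submodule.subtype _) := by
      rw [Submodule.span_le]
      rintro _ ⟨hp, a, ha, i, j, rfl⟩
      obtain ⟨p, rfl⟩ := Nat.exists_eq_add_of_le' hp
      exact ⟨⟨_, mul_mem_two p _ _ a ha⟩,
        pureClass_mul_divisorClass_mem p r i j ⟨a, ha⟩ _ rfl, rfl⟩
    obtain ⟨x', hx', e⟩ := hle hspan
    obtain rfl : x' = x := Subtype.ext e
    exact hx'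
  · match p with
    | 0 => exact bot_le
    | 1 => exact bot_le
    | p + 2 =>
      rintro _ ⟨y, rfl⟩
      exact pageSegre_d n p y

variable (Λ) in
/-- The embedding of `E_3^{p,0}` in `⋀V(1) ⊗ ℚ[x, y]`. -/
def e3Segre {n : ℕ} (hn : 1 ≤ n) (p : ℕ) :
    E3 Λ n p 0 →ₗ[ℚ] ExteriorAlgebra ℚ (sumZero n) ⊗[ℚ] MvPolynomial (Fin 2) ℚ :=
  Submodule.liftQ _ (pageSegre Λ n p ∘ₗ (cycles Λ n p 0).subtype) fun x hx => by
    have hx' : x.1 ∈ boundaries Λ n p 0 := hx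
    rwa [← ker_pageSegre hn] at hx'

lemma e3Segre_injective {n : ℕ} (hn : 1 ≤ n) (p : ℕ) : Function.Injective (e3Segre Λ hn p) := by
  rw [← LinearMap.ker_eq_bot]
  apply Submodule.ker_liftQ_eq_bot
  intro x hx
  have hx' : x.1 ∈ LinearMap.ker (pageSegre Λ n p) := hx
  rwa [ker_pageSegre hn] at hx'

lemma range_e3Segre {n : ℕ} (hn : 1 ≤ n) (p : ℕ) :
    LinearMap.range (e3Segre Λ hn p) = LinearMap.range (boxIncl ℚ (sumZero n) p) := by
  refine (Submodule.range_liftQ _ _ _).trans ?_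
  rw [LinearMap.range_comp, Submodule.range_subtype, cycles,
    Submodule.map_top, range_pageSegre]

lemma e3Segre_equivariant {n : ℕ} (hn : 1 ≤ n) (p : ℕ) (g : Equiv.Perm (Fin n) × SL2)
    (a : E3 Λ n p 0) : e3Segre Λ hn p (E3Rep Λ n p 0 g a) =
      Algebra.TensorProduct.map (ExteriorAlgebra.map (stdRep n g.1)) (polyAct g.2)
        (e3Segre Λ hn p a) := by
  induction a using Submodule.Quotient.induction_on with
  | _ x => exact pageSegre_equivariant n p g x.1

lemma boxIncl_equivariant (n p : ℕ) (g : Equiv.Perm (Fin n) × SL2)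
    (b : ⋀[ℚ]^p (sumZero n) ⊗[ℚ] MvPolynomial.homogeneousSubmodule (Fin 2) ℚ p) :
    boxIncl ℚ (sumZero n) p (box (extPowRep (stdRep n) p) (VRep p) g b) =
      Algebra.TensorProduct.map (ExteriorAlgebra.map (stdRep n g.1)) (polyAct g.2)
        (boxIncl ℚ (sumZero n) p b) := by
  induction b using TensorProduct.induction_on with
  | zero => rw [map_zero, map_zero, map_zero]
  | add x y hx hy => rw [map_add, map_add, hx, hy, map_add, map_add]
  | tmul ω f =>
    change (exteriorPower.map p (stdRep n g.1) ω).1 ⊗ₜ[ℚ] (VRep p g.2 f).1 =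
      ExteriorAlgebra.map (stdRep n g.1) ω.1 ⊗ₜ[ℚ] polyAct g.2 f.1
    rw [exteriorPower_map_coe]
    rfl

variable (Λ) in
/-- The isomorphism `E_3^{p,0} ≅ ⋀^p V(1) ⊠ V_p`. -/
def e3Equiv {n : ℕ} (hn : 1 ≤ n) (p : ℕ) :
    (E3Rep Λ n p 0).Equiv (box (extPowRep (stdRep n) p) (VRep p)) :=
  equivOfRangeEq (fun g : Equiv.Perm (Fin n) × SL2 => (Algebra.TensorProduct.map
      (ExteriorAlgebra.map (stdRep n g.1)) (polyAct g.2)).toLinearMap)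
    (e3Segre Λ hn p) (boxIncl ℚ (sumZero n) p) (e3Segre_injective hn p) (boxIncl_injective p)
    (range_e3Segre hn p) (e3Segre_equivariant hn p) (boxIncl_equivariant n p)

/-! ### Hook tableaux -/

lemma mem_hook {a b : ℕ} {c : ℕ × ℕ} :
    c ∈ (hook a b).cells ↔ c.1 ≤ b ∧ c.2 < a ∧ (c.1 = 0 ∨ c.2 = 0) := by
  simp only [hook, Finset.mem_filter, Finset.mem_product, Finset.mem_range]
  omega

lemma card_hook {a b : ℕ} (ha : 1 ≤ a) : (hook a b).cells.card = a + b := by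
  have : (hook a b).cells = Finset.disjUnion ((Finset.range (b + 1)).image fun k => (k, 0))
      ((Finset.Ico 1 a).image fun l => (0, l)) (by
        rw [Finset.disjoint_left]
        simp only [Finset.mem_image, Finset.mem_range, Finset.mem_Ico]
        rintro _ ⟨k, -, rfl⟩ ⟨l, hl, h⟩
        have := congrArg Prod.snd h
        simp at this
        omega) := by
    ext ⟨k, l⟩
    simp only [mem_hook, Finset.mem_disjUnion, Finset.mem_image, Finset.mem_range, Finset.mem_Ico,
      Prod.mk.injEq]
    constructor
    · rintro ⟨h1, h2, h3⟩
      by_cases hl : l = 0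
      · exact Or.inl ⟨k, by omega, rfl, hl.symm⟩
      · exact Or.inr ⟨l, by omega, by omega, rfl⟩
    · rintro (⟨k, hk, rfl, rfl⟩ | ⟨l, hl, rfl, rfl⟩) <;> omega
  rw [this, Finset.card_disjUnion,
    Finset.card_image_of_injective _ fun _ _ h => (Prod.ext_iff.1 h).1,
    Finset.card_image_of_injective _ fun _ _ h => (Prod.ext_iff.1 h).2, Finset.card_range,
    Nat.card_Ico]
  omega

/-- The tableaux of shape `(n - p, 1^p)`. -/
abbrev HookTableau (n p : ℕ) : Type := Fin n ≃ (hook (n - p) p).cells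

lemma HookTableau.mem {n p : ℕ} (T : HookTableau n p) (i : Fin n) : (T i).1.1 ≤ p ∧
    (T i).1.2 < n - p ∧ ((T i).1.1 = 0 ∨ (T i).1.2 = 0) := mem_hook.1 (T i).2

lemma HookTableau.eq_of_row_eq {n p : ℕ} (T : HookTableau n p) {i j : Fin n}
    (h : (T i).1.1 = (T j).1.1) (hi : (T i).1.1 ≠ 0) : i = j := by
  apply T.injective
  have h1 := T.mem i
  have h2 := T.mem j
  exact Subtype.ext (Prod.ext h (by omega))

/-- The entries of the first column, from top to bottom. -/
def HookTableau.column {n p : ℕ} (hp : p < n) (T : HookTableau n p) :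
    Fin (p + 1) ≃ {i // (T i).1.2 = 0} where
  toFun l := ⟨T.symm ⟨(l, 0), mem_hook.2 ⟨by omega, by omega, Or.inr rfl⟩⟩, by simp⟩
  invFun i := ⟨(T i.1).1.1, by have := T.mem i.1; omega⟩
  left_inv l := by simp
  right_inv i := by
    apply Subtype.ext
    simp only [Equiv.symm_apply_eq]
    exact Subtype.ext (Prod.ext rfl i.2.symm)

lemma HookTableau.apply_column {n p : ℕ} (hp : p < n) (T : HookTableau n p) (l : Fin (p + 1)) :
    (T (T.column hp l).1).1 = ((l : ℕ), 0) := by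
  simp [HookTableau.column]

lemma HookTableau.row_eq_zero {n p : ℕ} (T : HookTableau n p) {i : Fin n}
    (h : (T i).1.2 ≠ 0) : (T i).1.1 = 0 := by
  have := T.mem i
  omega

lemma exists_hookTableau {n p : ℕ} (hp : p < n) (c : Fin (p + 1) ↪ Fin n) :
    ∃ T : HookTableau n p, ∀ l, (T.column hp l).1 = c l := by
  have hcard : Fintype.card (Fin n) = Fintype.card (hook (n - p) p).cells := by
    rw [Fintype.card_fin, Fintype.card_coe, card_hook (by omega)]
    omega
  let T₀ : HookTableau n p := Fintype.equivOfCardEq hcard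
  have := Equiv.Perm.isMultiplyPretransitive (Fin n) (p + 1)
  obtain ⟨g, hg⟩ := MulAction.exists_smul_eq (Equiv.Perm (Fin n))
    ((T₀.column hp).toEmbedding.trans (Function.Embedding.subtype _)) c
  refine ⟨g.symm.trans T₀, fun l => ?_⟩
  rw [← hg]
  rfl

/-! ### Exterior powers in the tabloid module -/

open scoped Classical in
/-- The tabloids of shape `(n - p, 1^p)`, as functions that send an entry to its row. -/
def hookTabloids (n p : ℕ) : Finset (Fin n → ℕ) :=
  Finset.univ.image fun (T : HookTableau n p) i => (T i).1.1

lemma mem_hookTabloids {n p : ℕ} {f : Fin n → ℕ} :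
    f ∈ hookTabloids n p ↔ ∃ T : HookTableau n p, f = fun i => (T i).1.1 := by
  simp [hookTabloids, eq_comm]

lemma comp_mem_hookTabloids {n p : ℕ} {f : Fin n → ℕ} (hf : f ∈ hookTabloids n p)
    (π : Equiv.Perm (Fin n)) : f ∘ π ∈ hookTabloids n p := by
  obtain ⟨T, rfl⟩ := mem_hookTabloids.1 hf
  exact mem_hookTabloids.2 ⟨π.trans T, rfl⟩

/-- The sum of the coordinates of a vector over the entries of the row `k` of a tabloid. -/
def rowSum {n : ℕ} (f : Fin n → ℕ) (k : ℕ) : Module.Dual ℚ (Fin n → ℚ) :=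
  ∑ i, if f i = k then LinearMap.proj i else 0

lemma rowSum_apply {n : ℕ} (f : Fin n → ℕ) (k : ℕ) (v : Fin n → ℚ) :
    rowSum f k v = ∑ i, if f i = k then v i else 0 := by
  rw [rowSum, LinearMap.sum_apply]
  exact Finset.sum_congr rfl fun i _ => by split_ifs <;> simp

/-- The exterior product of the `p` functionals `rowSum f 1, …, rowSum f p`. -/
def rowForm {n : ℕ} (p : ℕ) (f : Fin n → ℕ) : Module.Dual ℚ (⋀[ℚ]^p (Fin n → ℚ)) :=
  exteriorPower.pairingDual ℚ _ p (exteriorPower.ιMulti ℚ p fun k : Fin p => rowSum f (k + 1))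

lemma rowForm_ιMulti {n p : ℕ} (f : Fin n → ℕ) (v : Fin p → Fin n → ℚ) :
    rowForm p f (exteriorPower.ιMulti ℚ p v) =
      (Matrix.of fun i j : Fin p => rowSum f (j + 1) (v i)).det := by
  rw [rowForm, exteriorPower.pairingDual_ιMulti_ιMulti]

/-- The map from `⋀^p V(1)` to the tabloid module whose coefficient at a tabloid, with entries
`d_1, …, d_p` in the rows below the first, is the minor `det (v_i(d_j))` of `v_1 ∧ ⋯ ∧ v_p`. -/
def tabloidExpansion (n p : ℕ) : ⋀[ℚ]^p (sumZero n) →ₗ[ℚ] ((Fin n → ℕ) →₀ ℚ) :=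
  ∑ f ∈ hookTabloids n p, Finsupp.lsingle f ∘ₗ rowForm p f ∘ₗ
    exteriorPower.map p (sumZero n).subtype

lemma tabloidExpansion_apply (n p : ℕ) (ω : ⋀[ℚ]^p (sumZero n)) :
    tabloidExpansion n p ω = ∑ f ∈ hookTabloids n p,
      Finsupp.single f (rowForm p f (exteriorPower.map p (sumZero n).subtype ω)) := by
  simp [tabloidExpansion]

lemma tabloidExpansion_apply_apply {n p : ℕ} {f : Fin n → ℕ} (hf : f ∈ hookTabloids n p)
    (ω : ⋀[ℚ]^p (sumZero n)) :
    tabloidExpansion n p ω f = rowForm p f (exteriorPower.map p (sumZero n).subtype ω) := by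
  rw [tabloidExpansion_apply, Finsupp.finsetSum_apply, Finset.sum_eq_single f]
  · simp
  · intro g _ hg
    exact Finsupp.single_eq_of_ne hg.symm
  · exact fun h => absurd hf h

lemma rowForm_stdRep {n p : ℕ} (f : Fin n → ℕ) (π : Equiv.Perm (Fin n))
    (ω : ⋀[ℚ]^p (sumZero n)) :
    rowForm p f (exteriorPower.map p (sumZero n).subtype
        (exteriorPower.map p (stdRep n π) ω)) =
      rowForm p (f ∘ π) (exteriorPower.map p (sumZero n).subtype ω) := by
  suffices H : rowForm p f ∘ₗ exteriorPower.map p (sumZero n).subtype ∘ₗ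
      exteriorPower.map p (stdRep n π) =
      rowForm p (f ∘ π) ∘ₗ exteriorPower.map p (sumZero n).subtype from LinearMap.congr_fun H ω
  apply exteriorPower.linearMap_ext
  ext u
  simp only [LinearMap.compAlternatingMap_apply, LinearMap.comp_apply,
    exteriorPower.map_apply_ιMulti, rowForm_ιMulti]
  congr 2
  ext i j
  simp only [Function.comp_apply, rowSum_apply]
  refine (Equiv.sum_comp π _).symm.trans (Finset.sum_congr rfl fun l _ => ?_)
  have : ((stdRep n π) (u i)).1 (π l) = (u i).1 l :=
    congrArg (u i).1 (π.symm_apply_apply l)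
  exact if_congr Iff.rfl this rfl

lemma tabloidExpansion_equivariant (n p : ℕ) (π : Equiv.Perm (Fin n))
    (ω : ⋀[ℚ]^p (sumZero n)) :
    tabloidExpansion n p (extPowRep (stdRep n) p π ω) =
      tabloidRep n π (tabloidExpansion n p ω) := by
  change tabloidExpansion n p (exteriorPower.map p (stdRep n π) ω) = _
  rw [tabloidExpansion_apply, tabloidExpansion_apply, map_sum]
  simp only [rowForm_stdRep]
  refine Finset.sum_bij' (fun f _ => f ∘ π) (fun f _ => f ∘ π.symm)
    (fun f hf => comp_mem_hookTabloids hf π) (fun f hf => comp_mem_hookTabloids hf π.symm)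
    (fun f _ => by funext i; simp) (fun f _ => by funext i; simp) fun f _ => ?_
  change _ = Finsupp.mapDomain _ (Finsupp.single _ _)
  rw [Finsupp.mapDomain_single]
  congr 1
  funext i
  simp

/-- The coefficients at the tabloids are the coordinates in the standard basis of `⋀^p ℚ^n`. The
assumption `p < n` provides an entry for the corner of the tableau. -/
lemma tabloidExpansion_injective {n p : ℕ} (hp : p < n) :
    Function.Injective (tabloidExpansion n p) := by
  rw [injective_iff_map_eq_zero]
  intro ω hω
  apply exteriorPower.map_injective_field (Submodule.subtype_injective (sumZero n))
  rw [map_zero]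
  apply ((Pi.basisFun ℚ (Fin n)).exteriorPower p).repr.injective
  ext1 s
  rw [exteriorPower.basis_repr_apply, map_zero, Finsupp.zero_apply]
  set e := Set.powersetCard.ofFinEmbEquiv.symm s with he
  obtain ⟨i₀, hi₀⟩ : ∃ i₀, i₀ ∉ Set.range e := by
    by_contra! h
    have := Fintype.card_le_of_surjective e h
    simp at this
    omega
  obtain ⟨T, hT⟩ := exists_hookTableau hp
    ⟨Fin.cons i₀ e, Fin.cons_injective_iff.2 ⟨hi₀, e.injective⟩⟩
  have hrow : ∀ k : Fin p, (T (e k)).1.1 = k + 1 := by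
    intro k
    have := hT k.succ
    simp only [Function.Embedding.coeFn_mk, Fin.cons_succ] at this
    rw [← this, T.apply_column]
    simp
  have h0 := tabloidExpansion_apply_apply (mem_hookTabloids.2 ⟨T, rfl⟩) ω
  rw [hω, Finsupp.zero_apply] at h0
  rw [h0]
  unfold exteriorPower.ιMultiDual rowForm exteriorPower.ιMulti_family
  congr 3
  funext k
  apply LinearMap.ext
  intro v
  rw [rowSum_apply, Finset.sum_eq_single (e k)]
  · rw [if_pos (hrow k)]
    simp [he]
  · intro i _ hi
    refine if_neg fun h => hi ?_
    exact T.eq_of_row_eq (h.trans (hrow k).symm) (by omega)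
  · simp

lemma det_eq_det_sub_of_row_sum_eq_one {p : ℕ} (N : Matrix (Fin (p + 1)) (Fin (p + 1)) ℚ)
    (h : ∀ l, ∑ k, N l k = 1) :
    N.det = (Matrix.of fun l k : Fin p => N l.succ k.succ - N 0 k.succ).det := by
  have h1 := Matrix.det_updateCol_sum N 0 fun _ => 1
  rw [one_smul] at h1
  rw [← h1]
  -- All the columns are added to the first, which becomes constant; then the first row is
  -- subtracted from the others.
  set A := N.updateCol 0 fun k => ∑ i, (1 : ℚ) • N k i with hA
  have hA0 : ∀ l, A l 0 = 1 := fun l => by simp [hA, h]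
  have hAs : ∀ l (k : Fin p), A l k.succ = N l k.succ := fun l k => by simp [hA]
  let B : Matrix (Fin (p + 1)) (Fin (p + 1)) ℚ := fun l k => if l = 0 then A 0 k else A l k - A 0 k
  have hdet : A.det = B.det := by
    refine Matrix.det_eq_of_forall_row_eq_smul_add_const (fun l => if l = 0 then 0 else 1) 0
      (if_pos rfl) fun l k => ?_
    by_cases hl : l = 0 <;> simp [B, hl]
  rw [hdet, Matrix.det_succ_column_zero, Finset.sum_eq_single 0]
  · simp only [Fin.val_zero, pow_zero, one_mul, Fin.succAbove_zero]
    have : B 0 0 = 1 := by simp [B, hA0]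
    rw [this, one_mul]
    refine congrArg Matrix.det (Matrix.ext fun l k => ?_)
    change (if l.succ = 0 then A 0 k.succ else A l.succ k.succ - A 0 k.succ) = _
    rw [if_neg (Fin.succ_ne_zero l), hAs, hAs]
    rfl
  · intro l _ hl
    have : B l 0 = 0 := by simp [B, hl, hA0]
    rw [this]; ring
  · simp

/-! ### Hook polytabloids as exterior products of roots -/

open scoped Classical in
/-- The tabloid with the entries of the first column of `T` permuted so that the `l`-th of them is in
the row `σ l`. -/
def HookTableau.relabel {n p : ℕ} (hp : p < n) (T : HookTableau n p)
    (σ : Equiv.Perm (Fin (p + 1))) (i : Fin n) : ℕ :=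
  if h : (T i).1.2 = 0 then σ ((T.column hp).symm ⟨i, h⟩) else 0

lemma HookTableau.relabel_column {n p : ℕ} (hp : p < n) (T : HookTableau n p)
    (σ : Equiv.Perm (Fin (p + 1))) (l : Fin (p + 1)) :
    T.relabel hp σ (T.column hp l).1 = σ l := by
  rw [relabel, dif_pos (T.column hp l).2, Subtype.coe_eta, Equiv.symm_apply_apply]

open scoped Classical in
lemma HookTableau.row_extendDomain_symm {n p : ℕ} (hp : p < n) (T : HookTableau n p)
    (σ : Equiv.Perm (Fin (p + 1))) (i : Fin n) :
    (T ((σ⁻¹.extendDomain (T.column hp)).symm i)).1.1 = T.relabel hp σ i := by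
  change (T ((σ⁻¹.extendDomain (T.column hp))⁻¹ i)).1.1 = _
  rw [Equiv.Perm.extendDomain_inv, inv_inv]
  by_cases h : (T i).1.2 = 0
  · obtain ⟨l, hl⟩ := (T.column hp).surjective ⟨i, h⟩
    obtain rfl : (T.column hp l).1 = i := congrArg Subtype.val hl
    rw [Equiv.Perm.extendDomain_apply_image, apply_column, relabel_column]
  · rw [Equiv.Perm.extendDomain_apply_not_subtype _ (T.column hp) h, relabel, dif_neg h,
      T.row_eq_zero h]

lemma HookTableau.relabel_mem {n p : ℕ} (hp : p < n) (T : HookTableau n p)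
    (σ : Equiv.Perm (Fin (p + 1))) : T.relabel hp σ ∈ hookTabloids n p := by
  classical
  refine mem_hookTabloids.2 ⟨(σ⁻¹.extendDomain (T.column hp)).symm.trans T, ?_⟩
  funext i
  exact (T.row_extendDomain_symm hp σ i).symm

/-- The permutations that preserve the columns of a hook tableau are the permutations of the first
column, since the other columns have one entry. The permutation `σ` of the rows corresponds to `σ⁻¹`
on the entries. -/
lemma HookTableau.polytabloid_eq {n p : ℕ} (hp : p < n) (T : HookTableau n p) :
    polytabloid (hook (n - p) p) T = ∑ σ : Equiv.Perm (Fin (p + 1)),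
      Finsupp.single (T.relabel hp σ) ((Equiv.Perm.sign σ : ℤ) : ℚ) := by
  classical
  rw [polytabloid, ← Finset.sum_filter]
  symm
  refine Finset.sum_bij (fun σ _ => σ⁻¹.extendDomain (T.column hp)) ?_ ?_ ?_ ?_
  · intro σ _
    rw [Finset.mem_filter]
    refine ⟨Finset.mem_univ _, fun i => ?_⟩
    by_cases h : (T i).1.2 = 0
    · rw [Equiv.Perm.extendDomain_apply_subtype _ (T.column hp) h, h]
      exact ((T.column hp) _).2
    · rw [Equiv.Perm.extendDomain_apply_not_subtype _ (T.column hp) h]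
  · intro σ _ τ _ h
    exact inv_injective (Equiv.Perm.extendDomainHom_injective (T.column hp) h)
  · intro g hg
    have hg' : ∀ i, (T (g i)).1.2 = (T i).1.2 := (Finset.mem_filter.1 hg).2
    let τ : Equiv.Perm (Fin (p + 1)) := (T.column hp).symm.permCongr
      (g.subtypePerm fun i => by rw [hg'])
    refine ⟨τ⁻¹, Finset.mem_univ _, ?_⟩
    rw [inv_inv]
    ext1 i
    by_cases h : (T i).1.2 = 0
    · rw [Equiv.Perm.extendDomain_apply_subtype _ (T.column hp) h]
      simp [τ, Equiv.permCongr_apply]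
    · rw [Equiv.Perm.extendDomain_apply_not_subtype _ (T.column hp) h]
      apply T.injective
      have h' : (T (g i)).1.2 ≠ 0 := by rwa [hg']
      exact Subtype.ext (Prod.ext ((T.row_eq_zero h).trans (T.row_eq_zero h').symm) (hg' i).symm)
  · intro σ _
    rw [Equiv.Perm.sign_extendDomain, map_inv, Int.units_inv_eq_self]
    congr 1
    funext i
    exact (T.row_extendDomain_symm hp σ i).symm

lemma HookTableau.eq_relabel_iff {n p : ℕ} (hp : p < n) (T : HookTableau n p) {f : Fin n → ℕ}
    (hf : f ∈ hookTabloids n p) (σ : Equiv.Perm (Fin (p + 1))) :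
    T.relabel hp σ = f ↔ ∀ l, f (T.column hp l).1 = σ l := by
  constructor
  · rintro rfl l
    exact T.relabel_column hp σ l
  · intro h
    obtain ⟨S, rfl⟩ := mem_hookTabloids.1 hf
    funext i
    by_cases hi : (T i).1.2 = 0
    · obtain ⟨l, hl⟩ := (T.column hp).surjective ⟨i, hi⟩
      obtain rfl : (T.column hp l).1 = i := congrArg Subtype.val hl
      rw [relabel_column]
      exact (h l).symm
    · rw [relabel, dif_neg hi]
      -- An entry of a lower row of `f` is the only one of its row, which already contains an entry of
      -- the first column of `T`.
      by_contra hne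
      have hle := (S.mem i).1
      obtain ⟨l, hl⟩ := σ.surjective ⟨(S i).1.1, by omega⟩
      have e : (S (T.column hp l).1).1.1 = (S i).1.1 := by
        have := h l
        simp only at this
        rw [this, hl]
      have := S.eq_of_row_eq e (fun h0 => hne (h0.symm.trans e))
      exact hi (this ▸ (T.column hp l).2)

/-- If `c_0, …, c_p` is the first column of `T`, then the polytabloid of `T` is the image of
`(e_{c_1} - e_{c_0}) ∧ ⋯ ∧ (e_{c_p} - e_{c_0})`. Its coefficient at a tabloid `f` is the determinant
of the `(p + 1) × (p + 1)` matrix with entries `1` if `f (c_l) = k` and `0` otherwise, which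
reduces to the `p × p` minor by `det_eq_det_sub_of_row_sum_eq_one`. -/
lemma HookTableau.tabloidExpansion_roots {n p : ℕ} (hp : p < n) (T : HookTableau n p) :
    tabloidExpansion n p (exteriorPower.ιMulti ℚ p fun l : Fin p =>
      root (T.column hp l.succ).1 (T.column hp 0).1) = polytabloid (hook (n - p) p) T := by
  classical
  rw [T.polytabloid_eq hp]
  ext f
  rw [Finsupp.finsetSum_apply]
  simp only [Finsupp.single_apply]
  by_cases hf : f ∈ hookTabloids n p
  · rw [tabloidExpansion_apply_apply hf, exteriorPower.map_apply_ιMulti, rowForm_ιMulti]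
    let N : Matrix (Fin (p + 1)) (Fin (p + 1)) ℚ :=
      fun l k => if f (T.column hp l).1 = k then 1 else 0
    have hN : ∀ l, ∑ k, N l k = 1 := by
      intro l
      obtain ⟨S, rfl⟩ := mem_hookTabloids.1 hf
      have hle := (S.mem (T.column hp l).1).1
      rw [Finset.sum_eq_single ⟨(S (T.column hp l).1).1.1, by omega⟩]
      · simp [N]
      · intro k _ hk
        exact if_neg fun h => hk (Fin.ext h.symm)
      · simp
    have hrow : ∀ (i j : Fin n) (k : ℕ), rowSum f k (root i j).1 =
        (if f i = k then 1 else 0) - (if f j = k then 1 else 0) := by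
      intro i j k
      simp [root, rowSum_apply, Pi.single_apply, ← Finset.sum_filter,
        Finset.sum_sub_distrib]
    have hdet := det_eq_det_sub_of_row_sum_eq_one N hN
    rw [← Matrix.det_transpose, Matrix.det_apply] at hdet
    have e : (Matrix.of fun i j : Fin p => rowSum f (j + 1)
        (((sumZero n).subtype ∘ fun l : Fin p =>
          root (T.column hp l.succ).1 (T.column hp 0).1) i)) =
        Matrix.of fun l k : Fin p => N l.succ k.succ - N 0 k.succ := by
      ext l k
      simp only [Matrix.of_apply, Function.comp_apply, Submodule.subtype_apply, hrow, N,
        Fin.val_succ]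
    rw [e, ← hdet]
    refine Finset.sum_congr rfl fun σ _ => ?_
    rw [Units.smul_def, zsmul_eq_mul]
    have hentry : ∀ l, Matrix.transpose N (σ l) l =
        if f (T.column hp l).1 = σ l then 1 else 0 := fun _ => rfl
    simp only [T.eq_relabel_iff hp hf, hentry]
    split_ifs with h
    · rw [Finset.prod_eq_one fun l _ => if_pos (h l), mul_one]
    · obtain ⟨l, hl⟩ := not_forall.1 h
      rw [Finset.prod_eq_zero (Finset.mem_univ l) (if_neg hl), mul_zero]
  · rw [Finset.sum_eq_zero fun σ _ => if_neg fun h : T.relabel hp σ = f =>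
        hf (h ▸ T.relabel_mem hp σ),
      tabloidExpansion_apply, Finsupp.finsetSum_apply]
    exact Finset.sum_eq_zero fun g hg => Finsupp.single_eq_of_ne fun h => hf (by rwa [h])

lemma range_tabloidExpansion {n p : ℕ} (hp : p < n) :
    LinearMap.range (tabloidExpansion n p) = spechtSpace n (hook (n - p) p) := by
  apply le_antisymm
  · let i₀ : Fin n := ⟨0, by omega⟩
    have hspan : Submodule.span ℚ (Set.range fun i => root i i₀) = ⊤ := by
      rw [eq_top_iff]
      intro v _
      rw [← sum_smul_root i₀ v]
      exact Submodule.sum_mem _ fun i _ => Submodule.smul_mem _ _ (Submodule.subset_span ⟨i, rfl⟩)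
    rw [LinearMap.range_eq_map, ← exteriorPower.ιMulti_span_of_span ℚ p _ hspan,
      Submodule.map_span, Submodule.span_le]
    rintro _ ⟨_, ⟨u, hu, rfl⟩, rfl⟩
    have hu' : ∀ l, ∃ i, root i i₀ = u l := fun l => hu ⟨l, rfl⟩
    choose b hb using hu'
    obtain rfl : (fun l => root (b l) i₀) = u := funext hb
    -- If `i₀, b 0, …, b (p-1)` are distinct, they are the first column of a tableau; otherwise the
    -- exterior product vanishes.
    by_cases hc : Function.Injective (Fin.cons i₀ b : Fin (p + 1) → Fin n)
    · obtain ⟨T, hT⟩ := exists_hookTableau hp ⟨_, hc⟩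
      have := T.tabloidExpansion_roots hp
      simp only [hT, Function.Embedding.coeFn_mk, Fin.cons_succ, Fin.cons_zero] at this
      rw [this]
      exact Submodule.subset_span ⟨T, rfl⟩
    · have h0 : exteriorPower.ιMulti ℚ p (fun l => root (b l) i₀) = 0 := by
        rw [Fin.cons_injective_iff, not_and_or, not_not] at hc
        rcases hc with ⟨l, hl⟩ | hc
        · refine AlternatingMap.map_coord_zero _ l (Subtype.ext ?_)
          simp [root, hl]
        · rw [Function.not_injective_iff] at hc
          obtain ⟨k, l, h, hne⟩ := hc
          exact AlternatingMap.map_eq_zero_of_eq _ _ (by simp only [h]) hne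
      rw [h0, map_zero]
      exact zero_mem _
  · rw [spechtSpace, Submodule.span_le]
    rintro _ ⟨T, rfl⟩
    exact ⟨_, HookTableau.tabloidExpansion_roots hp T⟩

/-- The isomorphism of `⋀^p V(1)` with the Specht module of the hook `(n - p, 1^p)`. -/
def extPowEquivSpecht {n p : ℕ} (hp : p < n) :
    (extPowRep (stdRep n) p).Equiv (spechtRep n (hook (n - p) p)) :=
  equivOfRangeEq (fun π => tabloidRep n π) (tabloidExpansion n p) (spechtSpace n _).subtype
    (tabloidExpansion_injective hp) (Submodule.subtype_injective _)
    (by rw [range_tabloidExpansion hp, Submodule.range_subtype])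
    (tabloidExpansion_equivariant n p) fun _ _ => rfl

/-- An isomorphism `V ≅ V'` induces `V ⊠ W ≅ V' ⊠ W`. -/
def boxCongrLeft {G H V V' W : Type*} [Monoid G] [Monoid H] [AddCommGroup V] [Module ℚ V]
    [AddCommGroup V'] [Module ℚ V'] [AddCommGroup W] [Module ℚ W] {ρ : Representation ℚ G V}
    {ρ' : Representation ℚ G V'} (e : ρ.Equiv ρ') (σ : Representation ℚ H W) :
    (box ρ σ).Equiv (box ρ' σ) :=
  Representation.Equiv.mk (TensorProduct.congr e.toLinearEquiv (LinearEquiv.refl ℚ W)) fun g => by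
    refine TensorProduct.ext' fun v w => ?_
    change e.toLinearEquiv (ρ g.1 v) ⊗ₜ[ℚ] σ g.2 w = ρ' g.1 (e.toLinearEquiv v) ⊗ₜ[ℚ] σ g.2 w
    rw [show e.toLinearEquiv (ρ g.1 v) = ρ' g.1 (e.toLinearEquiv v) from
      LinearMap.congr_fun (e.isIntertwining' g.1) v]

end

end EllipticBraid

theorem mainTheorem8 (Λ : PeriodPair) (n p : ℕ) (hn : 1 ≤ n) :
    Nonempty ((EllipticBraid.E3Rep Λ n p 0).Equiv
      (EllipticBraid.box (EllipticBraid.extPowRep (EllipticBraid.stdRep n) p)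
        (EllipticBraid.VRep p))) ∧
    (p ≤ n - 1 → Nonempty ((EllipticBraid.E3Rep Λ n p 0).Equiv
      (EllipticBraid.box (EllipticBraid.spechtRep n (EllipticBraid.hook (n - p) p))
        (EllipticBraid.VRep p)))) ∧
    Module.Finite ℚ (EllipticBraid.E3 Λ n p 0) ∧
    Module.finrank ℚ (EllipticBraid.E3 Λ n p 0) = (n - 1).choose p * (p + 1) := by
  refine ⟨⟨EllipticBraid.e3Equiv Λ hn p⟩, fun hp => ⟨(EllipticBraid.e3Equiv Λ hn p).trans
    (EllipticBraid.boxCongrLeft (EllipticBraid.extPowEquivSpecht (by omega)) _)⟩,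
    Module.Finite.equiv (EllipticBraid.e3Equiv Λ hn p).toLinearEquiv.symm, ?_⟩
  rw [(EllipticBraid.e3Equiv Λ hn p).toLinearEquiv.finrank_eq, EllipticBraid.finrank_box,
    EllipticBraid.finrank_sumZero hn]
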